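/- **Definitions.** Let $T_{\rm feq}$ be the first-order theory in the language $\{Q,P,E,R,F\}$ saying: the unary predicates $P$ and $Q$ are disjoint and cover the universe; $E$ is an equivalence relation on $Q$; $R\subseteq Q\times P$ is a binary relation such that $x\,R\,z$, $y\,R\,z$ and $x\,E\,y$ imply $x=y$; and $F$ is a function from $Q\times P$ to $Q$ such that $F(x,z)\,R\,z$ and $x\,E\,F(x,z)$ for all $x\in Q$, $z\in P$ (by convention $F(x,z)=x$ if $(x,z)\notin Q\times P$). A theory $T^*\supseteq T$ (up to logical consequence) in the same language is a *model completion* of $T$ if every model of $T$ embeds into a model of $T^*$ and, for every model $M$ of $T$, the theory $T^*\cup\mathrm{Diag}(M)$ is complete. A theory $T$ has $SOP_1$ if there are a formula $\varphi(\bar x,\bar y)$, a model $M$ of $T$ (for complete $T$ one may take the monster model) and tuples $\bar a_\eta$ in $M$, for $\eta\in{}^{\omega>}2$, such that (a) for every $\rho\in{}^{\omega}2$ the set $\{\varphi(\bar x,\bar a_{\rho\restriction n}):n<\omega\}$ is consistent, i.e. finitely satisfiable in $M$; (b) if $\nu\frown\langle 0\rangle\unlhd\eta\in{}^{\omega>}2$,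 then $\{\varphi(\bar x,\bar a_\eta),\varphi(\bar x,\bar a_{\nu\frown\langle 1\rangle})\}$ is inconsistent. $T$ is $NSOP_1$ if it does not have $SOP_1$. $T$ is *simple* if no formula has the tree property in a model $M$ of $T$, i.e. there are no $\varphi(\bar x,\bar y)$, $k<\omega$ and $(\bar a_\eta)_{\eta\in{}^{\omega>}\omega}$ in $M$ such that $\{\varphi(\bar x,\bar a_{\sigma\restriction n}):n<\omega\}$ is consistent for every $\sigma\in{}^\omega\omega$, while for every $\eta\in{}^{\omega>}\omega$ and any $k$ distinct $i_1,\dots,i_k<\omega$ the set $\{\varphi(\bar x,\bar a_{\eta\frown\langle i_j\rangle}):1\le j\le k\}$ is inconsistent. **Theorem.** $T_{\rm feq}$ has a model completion $T^*_{\rm feq}$. The theory $T^*_{\rm feq}$ (that is, any model completion of $T_{\rm feq}$) is complete and $NSOP_1$, but it is not simple. As every simple complete theory is $NSOP_1$, the class of simple theories is properly contained in the class of $NSOP_1$ theories. -/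

import Mathlib

open FirstOrder FirstOrder.Language

universe u v

/-! ### Consistency, `SOP₁`, the tree property, simplicity -/

section Classification

variable {L : FirstOrder.Language.{u, v}}

/-- The set of instances `{φ(x̄, b̄) : b̄ ∈ A}`, with parameters from `M`, is consistent (with the
elementary diagram of `M`): it is finitely satisfiable in `M`. -/
def ConsistentInstances {M : Type*} [L.Structure M] {n m : ℕ}
    (φ : L.Formula (Fin n ⊕ Fin m)) (A : Set (Fin m → M)) : Prop :=
  ∀ s : Finset (Fin m → M), (s : Set (Fin m → M)) ⊆ A →
    ∃ x : Fin n → M, ∀ b ∈ s, φ.Realize (Sum.elim x b)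

/-- The restriction `ρ ↾ k` of an infinite sequence, as a finite sequence of length `k`. -/
def initialSegment {α : Type*} (ρ : ℕ → α) (k : ℕ) : List α :=
  List.ofFn fun i : Fin k => ρ i

/-- `φ(x̄, ȳ)` and the tuples `(ā_η : η ∈ 2^{<ω})` of `M` exemplify `SOP₁`.
Finite binary sequences are lists of Booleans: `0` is `false`, `1` is `true`, and `<+:` is the
(non-strict) initial segment relation. -/
structure ExemplifiesSOP1 {M : Type*} [L.Structure M] {n m : ℕ}
    (φ : L.Formula (Fin n ⊕ Fin m)) (a : List Bool → Fin m → M) : Prop where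
  branch_consistent : ∀ ρ : ℕ → Bool,
    ConsistentInstances φ (Set.range fun k : ℕ => a (initialSegment ρ k))
  pair_inconsistent : ∀ ν η : List Bool, (ν ++ [false]) <+: η →
    ¬ ConsistentInstances φ {a η, a (ν ++ [true])}

/-- `T` has `SOP₁`: some formula and some tree of parameters in a model of `T` exemplify it.
For complete `T` this says that they can be found in the monster model, since every (small) model
of `T` is an elementary submodel of the monster model. -/
def HasSOP1 (T : L.Theory) : Prop :=
  ∃ (M : Theory.ModelType.{u, v, max u v} T) (n m : ℕ) (φ : L.Formula (Fin n ⊕ Fin m))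
    (a : List Bool → Fin m → M), ExemplifiesSOP1 φ a

/-- `φ(x̄, ȳ)` and the tuples `(ā_η : η ∈ ω^{<ω})` of `M` exemplify the tree property with
respect to `k`: branches are consistent, and the instances at any `k` distinct immediate successors
of a node are inconsistent. -/
structure ExemplifiesTreeProperty {M : Type*} [L.Structure M] {n m : ℕ}
    (φ : L.Formula (Fin n ⊕ Fin m)) (k : ℕ) (a : List ℕ → Fin m → M) : Prop where
  branch_consistent : ∀ σ : ℕ → ℕ,
    ConsistentInstances φ (Set.range fun l : ℕ => a (initialSegment σ l))
  siblings_inconsistent : ∀ (η : List ℕ) (I : Finset ℕ), I.card = k →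
    ¬ ConsistentInstances φ ((fun i : ℕ => a (η ++ [i])) '' (I : Set ℕ))

/-- `T` is simple: no formula has the tree property in a model of `T`. -/
def IsSimpleTheory (T : L.Theory) : Prop :=
  ¬ ∃ (M : Theory.ModelType.{u, v, max u v} T) (n m : ℕ) (φ : L.Formula (Fin n ⊕ Fin m))
    (k : ℕ) (a : List ℕ → Fin m → M), ExemplifiesTreeProperty φ k a

/-! ### Model completions -/

/-- `T'` is a model completion of `T`: `T'` extends `T`, every model of `T` embeds into a model of
`T'`, and for every model `M` of `T` the theory `T' ∪ Diag(M)` is complete, that is, any two models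
of `T'` extending `M` are elementarily equivalent over `M`. -/
structure IsModelCompletion (T T' : L.Theory) : Prop where
  extends_base : ∀ φ ∈ T, T' ⊨ᵇ φ
  embeds : ∀ M : Theory.ModelType.{u, v, max u v} T,
    ∃ N : Theory.ModelType.{u, v, max u v} T', Nonempty (M ↪[L] N)
  diagram_complete : ∀ (M : Theory.ModelType.{u, v, max u v} T)
    (N₁ N₂ : Theory.ModelType.{u, v, max u v} T') (f₁ : M ↪[L] N₁) (f₂ : M ↪[L] N₂)
    (n : ℕ) (φ : L.Formula (Fin n)) (c : Fin n → M),
    φ.Realize (f₁ ∘ c) ↔ φ.Realize (f₂ ∘ c)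

end Classification

/-! ### The theory `T_feq` -/

namespace Feq

inductive Func : ℕ → Type
  | F : Func 2

inductive Rel : ℕ → Type
  | P : Rel 1
  | Q : Rel 1
  | E : Rel 2
  | R : Rel 2

/-- The language `{Q, P, E, R, F}`. -/
def lang : FirstOrder.Language.{0, 0} := ⟨Func, Rel⟩

section

variable {α : Type} {n : ℕ}

def symP : lang.Relations 1 := Rel.P
def symQ : lang.Relations 1 := Rel.Q
def symE : lang.Relations 2 := Rel.E
def symR : lang.Relations 2 := Rel.R
def symF : lang.Functions 2 := Func.F

def isP (s : lang.Term (α ⊕ Fin n)) : lang.BoundedFormula α n := symP.boundedFormula₁ s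
def isQ (s : lang.Term (α ⊕ Fin n)) : lang.BoundedFormula α n := symQ.boundedFormula₁ s
def relE (s t : lang.Term (α ⊕ Fin n)) : lang.BoundedFormula α n := symE.boundedFormula₂ s t
def relR (s t : lang.Term (α ⊕ Fin n)) : lang.BoundedFormula α n := symR.boundedFormula₂ s t
def appF (s t : lang.Term (α ⊕ Fin n)) : lang.Term (α ⊕ Fin n) := symF.apply₂ s t

end

/-- `P` and `Q` are disjoint and cover the universe. -/
def axPartition : lang.Sentence :=
  ∀' ((isP &0 ⊔ isQ &0) ⊓ ∼(isP &0 ⊓ isQ &0))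

/-- `E ⊆ Q × Q`. -/
def axEDomain : lang.Sentence := ∀' ∀' (relE &0 &1 ⟹ (isQ &0 ⊓ isQ &1))

/-- `E` is reflexive on `Q`. -/
def axERefl : lang.Sentence := ∀' (isQ &0 ⟹ relE &0 &0)

/-- `E` is symmetric. -/
def axESymm : lang.Sentence := ∀' ∀' (relE &0 &1 ⟹ relE &1 &0)

/-- `E` is transitive. -/
def axETrans : lang.Sentence := ∀' ∀' ∀' ((relE &0 &1 ⊓ relE &1 &2) ⟹ relE &0 &2)

/-- `R ⊆ Q × P`. -/
def axRDomain : lang.Sentence := ∀' ∀' (relR &0 &1 ⟹ (isQ &0 ⊓ isP &1))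

/-- For `z ∈ P`, at most one element of any `E`-class is in the relation `R` with `z`. -/
def axRUnique : lang.Sentence :=
  ∀' ∀' ∀' ((relR &0 &2 ⊓ relR &1 &2 ⊓ relE &0 &1) ⟹ Term.bdEqual &0 &1)

/-- For `x ∈ Q` and `z ∈ P`: `F(x, z) ∈ Q`, `F(x, z) R z` and `x E F(x, z)`. -/
def axF : lang.Sentence :=
  ∀' ∀' ((isQ &0 ⊓ isP &1) ⟹
    (isQ (appF &0 &1) ⊓ relR (appF &0 &1) &1 ⊓ relE &0 (appF &0 &1)))

/-- The domain of the partial function `F` is `Q × P`. Function symbols being total in first-order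
logic, `F(x, z)` gets the conventional value `x` outside `Q × P`. -/
def axFOutside : lang.Sentence :=
  ∀' ∀' (∼(isQ &0 ⊓ isP &1) ⟹ Term.bdEqual (appF &0 &1) &0)

/-- The theory `T_feq`. -/
def theory : lang.Theory :=
  {axPartition, axEDomain, axERefl, axESymm, axETrans, axRDomain, axRUnique, axF, axFOutside}

end Feq

namespace Feq

/-! ### Models of `T_feq` -/

section Semantics

variable {N : Type*} [lang.Structure N]

/-! A model of `T_feq` consists of points (the part P) and classes, each class carrying the function
p ↦ F(·, p) from points to its own elements. So every model embeds in a `Frame`, given by an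
arbitrary map `f : C → P → V`, and extensions and amalgams are built by writing down such a map.
Since F(F(x,z),w) = F(x,w), a finite tuple generates the finite substructure formed by its `pairs`,
and its quantifier-free type amounts to finitely many conditions (`SameType`).

Existence. The theory `modelCompletion` says that every one-point extension of a finite tuple that
occurs in some model of `T_feq` is realized. Back and forth eliminates quantifiers
(`SameType.realize_iff`), so truth over a submodel depends on its diagram only. Every model embeds
in a rich frame (`exists_rich_frame`), where finitely many values of F can be prescribed at will,
and rich frames satisfy the extension axioms (`Rich.models`).

No `SOP₁`. By pigeonhole, a tree exemplifying `SOP₁` contains a sequence c_i along a branch and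
companions c'_i off it, alike in themselves and over the earlier c_h, such that φ(x,c'_i) and
φ(x,c_j) are inconsistent for i < j (`exists_parallel_sequences`). An ultrafilter yields i < j < N
such that a solution x of the first N instances has the same relations to c_i as to c_j, while c'_i
meets c_j only in the part common to c_i, c'_i and c_j (`eventually_meet`). Independent amalgamation
(`exists_amalgam`) then gives φ(x,c'_i) and φ(x,c_j) a common solution, a contradiction.

The rest is short. The formula y R x has the tree property, because one can choose freely in each
class the element related to a point. Completeness holds because a one-point model embeds in every
model of the completion. In general, `SOP₁` gives the tree property with k = 2, the nodes ξ⌢0^i⌢1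
serving as the successors of ξ. -/

def IsP (x : N) : Prop := Structure.RelMap symP ![x]
def IsQ (x : N) : Prop := Structure.RelMap symQ ![x]
def Eqv (x y : N) : Prop := Structure.RelMap symE ![x, y]
def Inc (x z : N) : Prop := Structure.RelMap symR ![x, z]
def app (x z : N) : N := Structure.funMap symF ![x, z]

variable (N) in
/-- The axioms of `T_feq`, semantically. -/
structure Axioms : Prop where
  isQ_iff : ∀ x : N, IsQ x ↔ ¬ IsP x
  eqv_dom : ∀ x y : N, Eqv x y → ¬ IsP x ∧ ¬ IsP y
  eqv_refl : ∀ x : N, ¬ IsP x → Eqv x x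
  eqv_symm : ∀ x y : N, Eqv x y → Eqv y x
  eqv_trans : ∀ x y z : N, Eqv x y → Eqv y z → Eqv x z
  inc_dom : ∀ x z : N, Inc x z → ¬ IsP x ∧ IsP z
  inc_unique : ∀ x y z : N, Inc x z → Inc y z → Eqv x y → x = y
  app_spec : ∀ x z : N, ¬ IsP x → IsP z → Inc (app x z) z ∧ Eqv x (app x z)
  app_out : ∀ x z : N, (IsP x ∨ ¬ IsP z) → app x z = x

theorem models_iff_axioms : N ⊨ theory ↔ Axioms N := by
  have hP : ∀ x : N, Structure.RelMap symP ![x] ↔ IsP x := fun _ => Iff.rfl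
  have hQ : ∀ x : N, Structure.RelMap symQ ![x] ↔ IsQ x := fun _ => Iff.rfl
  have hE : ∀ x y : N, Structure.RelMap symE ![x, y] ↔ Eqv x y := fun _ _ => Iff.rfl
  have hR : ∀ x y : N, Structure.RelMap symR ![x, y] ↔ Inc x y := fun _ _ => Iff.rfl
  have hF : ∀ x y : N, Structure.funMap symF ![x, y] = app x y := fun _ _ => rfl
  simp only [Theory.model_iff, theory, Set.mem_insert_iff, Set.mem_singleton_iff,
    forall_eq_or_imp, forall_eq, axPartition, axEDomain, axERefl, axESymm, axETrans, axRDomain,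
    axRUnique, axF, axFOutside, isP, isQ, relE, relR, appF, Sentence.Realize, Formula.Realize,
    BoundedFormula.realize_all, BoundedFormula.realize_inf, BoundedFormula.realize_sup,
    BoundedFormula.realize_not, BoundedFormula.realize_imp, BoundedFormula.realize_rel₁,
    BoundedFormula.realize_rel₂, BoundedFormula.realize_bdEqual, Term.realize_functions_apply₂,
    Term.realize_var, Sum.elim_inr, hP, hQ, hE, hR, hF, Fin.snoc, Function.comp_apply]
  simp
  constructor
  · rintro ⟨h1, h2, h3, h4, h5, h6, h7, h8, h9⟩
    have hq : ∀ x : N, IsQ x ↔ ¬ IsP x := fun x => by have := h1 x; tauto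
    refine ⟨hq, fun x y h => ?_, fun x h => h3 x ((hq x).2 h), h4, fun x y z => h5 x y z,
      fun x z h => ?_, fun x y z => h7 x y z, fun x z hx hz => ?_, fun x z h => h9 x z ?_⟩
    · exact ⟨(hq x).1 (h2 x y h).1, (hq y).1 (h2 x y h).2⟩
    · exact ⟨(hq x).1 (h6 x z h).1, (h6 x z h).2⟩
    · exact ⟨(h8 x z ((hq x).2 hx) hz).1.2, (h8 x z ((hq x).2 hx) hz).2⟩
    · rw [hq]; tauto
  · rintro ⟨hq, h2, h3, h4, h5, h6, h7, h8, h9⟩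
    simp only [hq]
    refine ⟨fun x => by tauto, h2, h3, h4, h5, h6, h7, fun x z hx hz => ?_, fun x z h => h9 x z ?_⟩
    · exact ⟨⟨(h2 _ _ (h8 x z hx hz).2).2, (h8 x z hx hz).1⟩, (h8 x z hx hz).2⟩
    · tauto

theorem axioms_of_model (N : Type*) [lang.Structure N] [h : N ⊨ theory] : Axioms N :=
  models_iff_axioms.1 h

namespace Axioms

variable (h : Axioms N)
include h

theorem isP_app (x z : N) : IsP (app x z) ↔ IsP x := by
  by_cases hx : IsP x
  · rw [h.app_out x z (Or.inl hx)]
  · by_cases hz : IsP z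
    · exact iff_of_false (h.eqv_dom _ _ (h.app_spec x z hx hz).2).2 hx
    · rw [h.app_out x z (Or.inr hz)]

theorem eqv_app {x : N} (hx : ¬ IsP x) (z : N) : Eqv x (app x z) := by
  by_cases hz : IsP z
  · exact (h.app_spec x z hx hz).2
  · rw [h.app_out x z (Or.inr hz)]; exact h.eqv_refl x hx

/-- The axioms make F(x,z) the only element of the class of x that is R-related to z, so F(·,z)
depends only on the class. -/
theorem app_congr {x y z : N} (hxy : Eqv x y) (hz : IsP z) : app x z = app y z := by
  have hx := (h.eqv_dom _ _ hxy).1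
  have hy := (h.eqv_dom _ _ hxy).2
  refine h.inc_unique _ _ z (h.app_spec x z hx hz).1 (h.app_spec y z hy hz).1 ?_
  exact h.eqv_trans _ _ _ (h.eqv_symm _ _ (h.eqv_app hx z))
    (h.eqv_trans _ _ _ hxy (h.eqv_app hy z))

/-- R is quantifier-free definable from P and F, which is why embeddings and types need only control
P, E and F. -/
theorem inc_iff (x z : N) : Inc x z ↔ ¬ IsP x ∧ IsP z ∧ app x z = x := by
  constructor
  · intro hi
    obtain ⟨hx, hz⟩ := h.inc_dom x z hi
    exact ⟨hx, hz, h.inc_unique _ _ z (h.app_spec x z hx hz).1 hi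
      (h.eqv_symm _ _ (h.app_spec x z hx hz).2)⟩
  · rintro ⟨hx, hz, he⟩
    rw [← he]; exact (h.app_spec x z hx hz).1

theorem app_app {x z : N} (hx : ¬ IsP x) {w : N} (hw : IsP w) : app (app x z) w = app x w :=
  (h.app_congr (h.eqv_app hx z) hw).symm

theorem app_self (x : N) : app x x = x := h.app_out x x (em _)

end Axioms

end Semantics

section Embedding

variable {N N' : Type*} [lang.Structure N] [lang.Structure N']

/-- Maps preserving `P`, `E` and `F` are embeddings of models of `T_feq`. -/
def embeddingOfMap (h : Axioms N) (h' : Axioms N') (g : N → N') (inj : Function.Injective g)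
    (hP : ∀ x, IsP (g x) ↔ IsP x) (hE : ∀ x y, Eqv (g x) (g y) ↔ Eqv x y)
    (hF : ∀ x z, g (app x z) = app (g x) (g z)) : N ↪[lang] N' where
  toFun := g
  inj' := inj
  map_fun' := by
    rintro n f xs
    cases f
    obtain ⟨x, z, rfl⟩ : ∃ x z, xs = ![x, z] := ⟨xs 0, xs 1, by ext i; fin_cases i <;> rfl⟩
    have e : g ∘ ![x, z] = ![g x, g z] := by ext i; fin_cases i <;> rfl
    exact (hF x z).trans (congrArg (Structure.funMap symF) e.symm)
  map_rel' := by
    have e1 : ∀ xs : Fin 1 → N, ∃ x, xs = ![x] := fun xs =>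
      ⟨xs 0, by ext i; fin_cases i; rfl⟩
    have e2 : ∀ xs : Fin 2 → N, ∃ x z, xs = ![x, z] := fun xs =>
      ⟨xs 0, xs 1, by ext i; fin_cases i <;> rfl⟩
    have e3 : ∀ x, g ∘ ![x] = ![g x] := fun x => by ext i; fin_cases i; rfl
    have e4 : ∀ x z, g ∘ ![x, z] = ![g x, g z] := fun x z => by ext i; fin_cases i <;> rfl
    rintro n r xs
    cases r
    · obtain ⟨x, rfl⟩ := e1 xs
      exact (iff_of_eq (congrArg (Structure.RelMap symP) (e3 x))).trans (hP x)
    · obtain ⟨x, rfl⟩ := e1 xs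
      exact (iff_of_eq (congrArg (Structure.RelMap symQ) (e3 x))).trans
        ((h'.isQ_iff _).trans ((not_congr (hP _)).trans (h.isQ_iff _).symm))
    · obtain ⟨x, z, rfl⟩ := e2 xs
      exact (iff_of_eq (congrArg (Structure.RelMap symE) (e4 x z))).trans (hE x z)
    · obtain ⟨x, z, rfl⟩ := e2 xs
      refine (iff_of_eq (congrArg (Structure.RelMap symR) (e4 x z))).trans ?_
      change Inc (g x) (g z) ↔ Inc x z
      rw [h.inc_iff, h'.inc_iff, hP, hP, ← hF, inj.eq_iff]

theorem embedding_isP (g : N ↪[lang] N') (x : N) : IsP (g x) ↔ IsP x := by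
  have := g.map_rel symP ![x]
  rwa [show g ∘ ![x] = ![g x] by ext i; fin_cases i; rfl] at this

end Embedding

/-! ### Frames -/

/-- The structure with `P`-part `P`, all of whose `E`-classes are indexed by `C` and identified
with `V`, the function `F` being given by `f`. -/
def Frame {P C V : Type*} (_ : C → P → V) : Type _ := P ⊕ C × V

namespace Frame

variable {P C V : Type*} {f : C → P → V}

def point (p : P) : Frame f := Sum.inl p
def elt (c : C) (v : V) : Frame f := Sum.inr (c, v)

def appFun : Frame f → Frame f → Frame f
  | Sum.inr (c, _), Sum.inl p => elt c (f c p)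
  | x, _ => x

instance : lang.Structure (Frame f) where
  funMap := fun g xs => match g with
    | .F => appFun (xs 0) (xs 1)
  RelMap := fun r xs => match r with
    | .P => (xs 0).isLeft = true
    | .Q => (xs 0).isRight = true
    | .E => ∃ c v w, xs 0 = elt c v ∧ xs 1 = elt c w
    | .R => ∃ c p, xs 0 = elt c (f c p) ∧ xs 1 = point p

@[simp] theorem isP_point (p : P) : IsP (point p : Frame f) := rfl

@[simp] theorem not_isP_elt (c : C) (v : V) : ¬ IsP (elt c v : Frame f) := by
  intro h; cases h

@[simp] theorem not_isQ_point (p : P) : ¬ IsQ (point p : Frame f) := by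
  intro h; cases h

@[simp] theorem isQ_elt (c : C) (v : V) : IsQ (elt c v : Frame f) := rfl

theorem elt_inj {c c' : C} {v v' : V} : (elt c v : Frame f) = elt c' v' ↔ c = c' ∧ v = v' :=
  ⟨fun h => by cases h; exact ⟨rfl, rfl⟩, fun h => by rw [h.1, h.2]⟩

theorem point_inj {p p' : P} : (point p : Frame f) = point p' ↔ p = p' :=
  ⟨fun h => by cases h; rfl, fun h => by rw [h]⟩

theorem elt_ne_point {c : C} {v : V} {p : P} : (elt c v : Frame f) ≠ point p := by
  intro h; cases h

theorem eqv_iff (x y : Frame f) : Eqv x y ↔ ∃ c v w, x = elt c v ∧ y = elt c w := Iff.rfl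
theorem inc_iff (x y : Frame f) : Inc x y ↔ ∃ c p, x = elt c (f c p) ∧ y = point p := Iff.rfl

theorem eqv_elt {c c' : C} {v v' : V} : Eqv (elt c v : Frame f) (elt c' v') ↔ c = c' := by
  rw [eqv_iff]
  constructor
  · rintro ⟨d, a, b, h1, h2⟩
    rw [elt_inj] at h1 h2
    exact h1.1.trans h2.1.symm
  · rintro rfl
    exact ⟨c, v, v', rfl, rfl⟩

@[simp] theorem app_elt_point (c : C) (v : V) (p : P) :
    app (elt c v : Frame f) (point p) = elt c (f c p) := rfl
@[simp] theorem app_elt_elt (c c' : C) (v v' : V) :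
    app (elt c v : Frame f) (elt c' v') = elt c v := rfl
@[simp] theorem app_point (p : P) (x : Frame f) : app (point p) x = point p := rfl

theorem cases (x : Frame f) : (∃ p, x = point p) ∨ ∃ c v, x = elt c v := by
  rcases x with p | ⟨c, v⟩
  exacts [Or.inl ⟨p, rfl⟩, Or.inr ⟨c, v, rfl⟩]

theorem axioms (f : C → P → V) : Axioms (Frame f) where
  isQ_iff x := by rcases cases x with ⟨p, rfl⟩ | ⟨c, v, rfl⟩ <;> simp
  eqv_dom x y := by rintro ⟨c, v, w, h1, h2⟩; simp at h1 h2; subst h1 h2; simp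
  eqv_refl x h := by
    rcases cases x with ⟨p, rfl⟩ | ⟨c, v, rfl⟩
    · simp at h
    · exact eqv_elt.2 rfl
  eqv_symm x y := by rintro ⟨c, v, w, h1, h2⟩; simp at h1 h2; subst h1 h2; exact eqv_elt.2 rfl
  eqv_trans x y z := by
    rintro ⟨c, v, w, h1, h2⟩ ⟨c', v', w', h3, h4⟩
    simp at h1 h2 h3 h4
    subst h1 h2 h4
    exact eqv_elt.2 (elt_inj.1 h3).1
  inc_dom x z := by rintro ⟨c, p, h1, h2⟩; simp at h1 h2; subst h1 h2; simp
  inc_unique x y z := by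
    rintro ⟨c, p, h1, h2⟩ ⟨c', p', h3, h4⟩ h
    simp at h1 h2 h3 h4
    subst h1 h2 h3
    obtain rfl := eqv_elt.1 h
    rw [point_inj] at h4
    rw [h4]
  app_spec x z hx hz := by
    rcases cases x with ⟨p, rfl⟩ | ⟨c, v, rfl⟩
    · simp at hx
    rcases cases z with ⟨p, rfl⟩ | ⟨c', v', rfl⟩
    · exact ⟨⟨c, p, rfl, rfl⟩, eqv_elt.2 rfl⟩
    · simp at hz
  app_out x z h := by
    rcases cases x with ⟨p, rfl⟩ | ⟨c, v, rfl⟩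
    · rfl
    rcases cases z with ⟨p, rfl⟩ | ⟨c', v', rfl⟩
    · simp at h
    · rfl

instance : (Frame f) ⊨ theory := models_iff_axioms.2 (axioms f)

/-- An embedding of a model of `T_feq` in a frame, from its components. -/
theorem exists_embedding {N : Type*} [lang.Structure N] (h : Axioms N) (π : N → P) (γ : N → C)
    (ν : N → V) (hπ : ∀ p p', IsP p → IsP p' → π p = π p' → p = p')
    (hγ : ∀ q q', ¬ IsP q → ¬ IsP q' → (γ q = γ q' ↔ Eqv q q'))
    (hν : ∀ q q', Eqv q q' → ν q = ν q' → q = q')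
    (hf : ∀ q p, ¬ IsP q → IsP p → f (γ q) (π p) = ν (app q p)) :
    ∃ g : N ↪[lang] Frame f, (∀ p, IsP p → g p = point (π p)) ∧
      ∀ q, ¬ IsP q → g q = elt (γ q) (ν q) := by
  classical
  let g : N → Frame f := fun x => if IsP x then point (π x) else elt (γ x) (ν x)
  have g1 : ∀ p, IsP p → g p = point (π p) := fun p hp => if_pos hp
  have g2 : ∀ p, ¬ IsP p → g p = elt (γ p) (ν p) := fun p hp => if_neg hp
  refine ⟨embeddingOfMap h (axioms f) g ?_ ?_ ?_ ?_, g1, g2⟩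
  · intro x y hxy
    by_cases hx : IsP x <;> by_cases hy : IsP y
    · rw [g1 x hx, g1 y hy, point_inj] at hxy
      exact hπ x y hx hy hxy
    · rw [g1 x hx, g2 y hy] at hxy
      exact absurd hxy.symm elt_ne_point
    · rw [g2 x hx, g1 y hy] at hxy
      exact absurd hxy elt_ne_point
    · rw [g2 x hx, g2 y hy, elt_inj] at hxy
      exact hν x y ((hγ x y hx hy).1 hxy.1) hxy.2
  · intro x
    by_cases hx : IsP x
    · simp [g1 x hx, hx]
    · simp [g2 x hx, hx]
  · intro x y
    by_cases hx : IsP x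
    · refine iff_of_false (fun he => ((axioms f).eqv_dom _ _ he).1 ?_)
        (fun he => (h.eqv_dom _ _ he).1 hx)
      simp [g1 x hx]
    by_cases hy : IsP y
    · refine iff_of_false (fun he => ((axioms f).eqv_dom _ _ he).2 ?_)
        (fun he => (h.eqv_dom _ _ he).2 hy)
      simp [g1 y hy]
    rw [g2 x hx, g2 y hy, eqv_elt, hγ x y hx hy]
  · intro x z
    by_cases hx : IsP x
    · rw [h.app_out x z (Or.inl hx), g1 x hx, app_point]
    by_cases hz : IsP z
    · have hq : ¬ IsP (app x z) := by rwa [h.isP_app]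
      rw [g2 x hx, g1 z hz, g2 _ hq, app_elt_point, hf x z hx hz,
        (hγ _ _ hq hx).2 (h.eqv_symm _ _ (h.eqv_app hx z))]
    · rw [h.app_out x z (Or.inr hz), g2 x hx, g2 z hz, app_elt_elt]

end Frame

/-! ### Representatives of `E`-classes -/

section Classes

variable {N : Type*} [lang.Structure N]

/-- The equivalence relation `E`, extended by equality. -/
def Axioms.classSetoid (h : Axioms N) : Setoid N where
  r x y := x = y ∨ Eqv x y
  iseqv :=
    { refl := fun _ => Or.inl rfl
      symm := by
        rintro x y (rfl | hxy)
        exacts [Or.inl rfl, Or.inr (h.eqv_symm _ _ hxy)]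
      trans := by
        rintro x y z (rfl | hxy) (rfl | hyz)
        exacts [Or.inl rfl, Or.inr hyz, Or.inr hxy, Or.inr (h.eqv_trans _ _ _ hxy hyz)] }

/-- The type of `E`-classes of a model of `T_feq` (and of elements of `P`). -/
def Axioms.Cls (h : Axioms N) : Type _ := Quotient h.classSetoid

def Axioms.cls (h : Axioms N) (x : N) : h.Cls := Quotient.mk h.classSetoid x

noncomputable def Axioms.rep (h : Axioms N) (c : h.Cls) : N := Quotient.out c

theorem Axioms.cls_eq_iff (h : Axioms N) {x y : N} (hx : ¬ IsP x) :
    h.cls x = h.cls y ↔ Eqv x y := by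
  refine (Quotient.eq (r := h.classSetoid)).trans ⟨?_, Or.inr⟩
  rintro (rfl | hxy)
  exacts [h.eqv_refl _ hx, hxy]

theorem Axioms.eqv_rep (h : Axioms N) {x : N} (hx : ¬ IsP x) : Eqv x (h.rep (h.cls x)) :=
  (h.cls_eq_iff hx).1 (Quotient.out_eq (h.cls x)).symm

theorem Axioms.app_rep (h : Axioms N) {x p : N} (hx : ¬ IsP x) (hp : IsP p) :
    app (h.rep (h.cls x)) p = app x p :=
  (h.app_congr (h.eqv_rep hx) hp).symm

end Classes

/-- Independent amalgamation: the types of `x` over `b₀` and over `d` are simultaneously realized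
over a copy `b` of `b₀` and over `d`, provided that `b` and `d` meet only in the part of `d` that
is common to `b₀`, `b` and `d`. The tuples `b₀`, `b` and `d` enumerate substructures. -/
theorem exists_amalgam {N : Type} [lang.Structure N] (h : Axioms N) {ι σ : Type}
    (b₀ b d : ι → N) (x : σ → N) (m m' : ι → ι → ι)
    (closed_b₀ : ∀ k l, app (b₀ k) (b₀ l) = b₀ (m k l))
    (closed_b : ∀ k l, app (b k) (b l) = b (m k l))
    (closed_d : ∀ k l, app (d k) (d l) = d (m' k l))
    (b_eq : ∀ k l, b₀ k = b₀ l ↔ b k = b l)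
    (b_isP : ∀ k, IsP (b₀ k) ↔ IsP (b k))
    (b_eqv : ∀ k l, Eqv (b₀ k) (b₀ l) ↔ Eqv (b k) (b l))
    (meet_eq : ∀ l, (b₀ l = d l ∧ b l = d l) ∨ (b₀ l ≠ d l ∧ ∀ k, b k ≠ d l))
    (meet_eqv : ∀ l, (Eqv (b₀ l) (d l) ∧ Eqv (b l) (d l)) ∨
      (¬ Eqv (b₀ l) (d l) ∧ ∀ k, ¬ Eqv (b k) (d l)))
    (x_eq : ∀ s k, x s = b₀ k ↔ x s = d k)
    (x_eqv : ∀ s k, Eqv (x s) (b₀ k) ↔ Eqv (x s) (d k))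
    (x_app : ∀ s k n, app (b₀ k) (x s) = b₀ n ↔ app (d k) (x s) = d n) :
    ∃ (N' : Type) (_ : lang.Structure N') (_ : N' ⊨ theory) (e gd gb : N ↪[lang] N'),
      (∀ k, gd (d k) = e (d k)) ∧ (∀ k, gb (b₀ k) = e (b k)) ∧ ∀ s, gd (x s) = gb (x s) := by
  classical
  obtain ⟨s, hs⟩ : ∃ s : N → N, ∀ k, s (b₀ k) = b k :=
    ⟨Function.extend b₀ b id, fun k =>
      Function.FactorsThrough.extend_apply (fun _ _ e => (b_eq _ _).1 e) _ k⟩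
  obtain ⟨t, ht⟩ : ∃ t : N → N, ∀ k, t (b k) = b₀ k :=
    ⟨Function.extend b b₀ id, fun k =>
      Function.FactorsThrough.extend_apply (fun _ _ e => (b_eq _ _).2 e) _ k⟩
  have symm := h.eqv_symm
  have trans := h.eqv_trans
  -- `r` carries a class meeting `b₀` to the corresponding class meeting `b`; `r'` below goes back,
  -- returning an element of the class met by `b₀`.
  obtain ⟨r, hr⟩ : ∃ r : N → h.Cls, ∀ k q, Eqv (b₀ k) q → r q = h.cls (b k) := by
    refine ⟨fun q => if hk : ∃ k, Eqv (b₀ k) q then h.cls (b hk.choose) else h.cls q,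
      fun k q hq => ?_⟩
    have hk : ∃ k, Eqv (b₀ k) q := ⟨k, hq⟩
    have h1 : Eqv (b hk.choose) (b k) :=
      (b_eqv _ _).1 (trans _ _ _ hk.choose_spec (symm _ _ hq))
    simp only [dif_pos hk]
    exact (h.cls_eq_iff (h.eqv_dom _ _ h1).1).2 h1
  obtain ⟨r', hr'⟩ : ∃ r' : h.Cls → N, ∀ k, ¬ IsP (b k) → Eqv (b₀ k) (r' (h.cls (b k))) := by
    refine ⟨fun c => if hk : ∃ k, ¬ IsP (b k) ∧ h.cls (b k) = c then b₀ hk.choose else h.rep c,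
      fun k hq => ?_⟩
    have hk : ∃ k', ¬ IsP (b k') ∧ h.cls (b k') = h.cls (b k) := ⟨k, hq, rfl⟩
    simp only [dif_pos hk]
    exact symm _ _ ((b_eqv _ _).2 ((h.cls_eq_iff hk.choose_spec.1).1 hk.choose_spec.2))
  let νd : N → N ⊕ N := fun q => if q ∈ Set.range d then Sum.inl q else Sum.inr q
  let νb : N → N ⊕ N := fun q => if q ∈ Set.range b₀ then Sum.inl (s q) else Sum.inr q
  -- Left summands form the copy `e` of N containing `b` and `d`; right summands are new and are
  -- shared by `gd` and `gb` where possible. The flag on a new point is true if it comes through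
  -- `gd`, or through `gb` from a coordinate of `x`; thus coordinates of `x` get one image and other
  -- new points of `gb` stay apart from those of `gd`. An old class at a new point must follow `d`
  -- if the flag holds and `d` meets the class, and otherwise follows `b₀`.
  let f : h.Cls ⊕ h.Cls → N ⊕ N × Prop → N ⊕ N
    | Sum.inl c, Sum.inl p => Sum.inl (app (h.rep c) p)
    | Sum.inr c, Sum.inl p => Sum.inr (app (h.rep c) (if p ∈ Set.range b then t p else p))
    | Sum.inr c, Sum.inr (p, _) => Sum.inr (app (h.rep c) p)
    | Sum.inl c, Sum.inr (p, i) =>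
        if i ∧ ∃ l, ¬ IsP (d l) ∧ h.cls (d l) = c then νd (app (h.rep c) p) else νb (app (r' c) p)
  have clsE : ∀ q q', ¬ IsP q → (h.cls q = h.cls q' ↔ Eqv q q') := fun q q' hq => h.cls_eq_iff hq
  have νd_pos : ∀ k, νd (d k) = Sum.inl (d k) := fun k => if_pos ⟨k, rfl⟩
  have νb_pos : ∀ k, νb (b₀ k) = Sum.inl (b k) := fun k => (if_pos ⟨k, rfl⟩).trans (by rw [hs])
  have νd_neg : ∀ q, (∀ k, d k ≠ q) → νd q = Sum.inr q := fun q hq =>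
    if_neg fun ⟨k, hk⟩ => hq k hk
  have νb_neg : ∀ q, (∀ k, b₀ k ≠ q) → νb q = Sum.inr q := fun q hq =>
    if_neg fun ⟨k, hk⟩ => hq k hk
  -- the components of the two new embeddings
  let πd : N → N ⊕ N × Prop := fun p => if p ∈ Set.range d then Sum.inl p else Sum.inr (p, True)
  let πb : N → N ⊕ N × Prop := fun p =>
    if p ∈ Set.range b₀ then Sum.inl (s p) else Sum.inr (p, p ∈ Set.range x)
  have πd_pos : ∀ k, πd (d k) = Sum.inl (d k) := fun k => if_pos ⟨k, rfl⟩
  have πb_pos : ∀ k, πb (b₀ k) = Sum.inl (b k) := fun k => (if_pos ⟨k, rfl⟩).trans (by rw [hs])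
  have πd_neg : ∀ q, (∀ k, d k ≠ q) → πd q = Sum.inr (q, True) := fun q hq =>
    if_neg fun ⟨k, hk⟩ => hq k hk
  have πb_neg : ∀ q, (∀ k, b₀ k ≠ q) → πb q = Sum.inr (q, q ∈ Set.range x) := fun q hq =>
    if_neg fun ⟨k, hk⟩ => hq k hk
  let γd : N → h.Cls ⊕ h.Cls := fun q =>
    if ∃ k, Eqv (d k) q then Sum.inl (h.cls q) else Sum.inr (h.cls q)
  let γb : N → h.Cls ⊕ h.Cls := fun q =>
    if ∃ k, Eqv (b₀ k) q then Sum.inl (r q) else Sum.inr (h.cls q)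
  have γd_pos : ∀ k q, Eqv (d k) q → γd q = Sum.inl (h.cls q) := fun k q hk => if_pos ⟨k, hk⟩
  have γb_pos : ∀ k q, Eqv (b₀ k) q → γb q = Sum.inl (h.cls (b k)) := fun k q hk =>
    (if_pos ⟨k, hk⟩).trans (by rw [hr k q hk])
  have γd_neg : ∀ q, (∀ k, ¬ Eqv (d k) q) → γd q = Sum.inr (h.cls q) := fun q hq =>
    if_neg fun ⟨k, hk⟩ => hq k hk
  have γb_neg : ∀ q, (∀ k, ¬ Eqv (b₀ k) q) → γb q = Sum.inr (h.cls q) := fun q hq =>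
    if_neg fun ⟨k, hk⟩ => hq k hk
  have split : ∀ (u : ι → N) (q : N), (∃ k, u k = q) ∨ ∀ k, u k ≠ q := fun u q => by
    by_cases hk : ∃ k, u k = q
    exacts [Or.inl hk, Or.inr (by simpa using hk)]
  have splitE : ∀ (u : ι → N) (q : N), (∃ k, Eqv (u k) q) ∨ ∀ k, ¬ Eqv (u k) q := fun u q => by
    by_cases hk : ∃ k, Eqv (u k) q
    exacts [Or.inl hk, Or.inr (by simpa using hk)]
  have new_app : ∀ (u : ι → N) (q p : N), ¬ IsP q → (∀ k, ¬ Eqv (u k) q) →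
      ∀ k, u k ≠ app q p := fun u q p hq hu k hk =>
    hu k (hk ▸ symm _ _ (h.eqv_app hq p))
  obtain ⟨e, e1, e2⟩ := Frame.exists_embedding (f := f) h Sum.inl (fun q => Sum.inl (h.cls q))
    Sum.inl (fun p p' _ _ hp => Sum.inl_injective hp)
    (fun q q' hq _ => by rw [Sum.inl_injective.eq_iff, clsE _ _ hq])
    (fun q q' _ hq => Sum.inl_injective hq)
    (fun q p hq hp => by simp only [f]; rw [h.app_rep hq hp])
  obtain ⟨gd, d1, d2⟩ : ∃ g : N ↪[lang] Frame f, (∀ p, IsP p → g p = Frame.point (πd p)) ∧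
      ∀ q, ¬ IsP q → g q = Frame.elt (γd q) (νd q) := by
    refine Frame.exists_embedding h πd γd νd ?_ ?_ ?_ ?_
    · intro p p' _ _ hp
      rcases split d p with ⟨k, rfl⟩ | hk <;> rcases split d p' with ⟨k', rfl⟩ | hk'
      · rw [πd_pos, πd_pos] at hp; exact Sum.inl_injective hp
      · rw [πd_pos, πd_neg _ hk'] at hp; cases hp
      · rw [πd_pos, πd_neg _ hk] at hp; cases hp
      · rw [πd_neg _ hk, πd_neg _ hk'] at hp; exact (Prod.ext_iff.1 (Sum.inr_injective hp)).1
    · intro q q' hq hq'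
      rcases splitE d q with ⟨k, hk⟩ | hk <;> rcases splitE d q' with ⟨k', hk'⟩ | hk'
      · rw [γd_pos k q hk, γd_pos k' q' hk', Sum.inl_injective.eq_iff, clsE _ _ hq]
      · rw [γd_pos k q hk, γd_neg _ hk']
        exact iff_of_false (by simp) fun he => hk' k (trans _ _ _ hk he)
      · rw [γd_pos k' q' hk', γd_neg _ hk]
        exact iff_of_false (by simp) fun he => hk k' (trans _ _ _ hk' (symm _ _ he))
      · rw [γd_neg _ hk, γd_neg _ hk', Sum.inr_injective.eq_iff, clsE _ _ hq]
    · intro q q' _ hp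
      rcases split d q with ⟨k, rfl⟩ | hk <;> rcases split d q' with ⟨k', rfl⟩ | hk'
      · rw [νd_pos, νd_pos] at hp; exact Sum.inl_injective hp
      · rw [νd_pos, νd_neg _ hk'] at hp; cases hp
      · rw [νd_pos, νd_neg _ hk] at hp; cases hp
      · rw [νd_neg _ hk, νd_neg _ hk'] at hp; exact Sum.inr_injective hp
    · intro q p hq hp
      rcases splitE d q with ⟨k, hk⟩ | hk
      · rw [γd_pos k q hk]
        rcases split d p with ⟨l, rfl⟩ | hl
        · rw [πd_pos, ← h.app_congr hk hp, closed_d, νd_pos, ← closed_d]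
          simp only [f]
          rw [h.app_rep hq hp, h.app_congr hk hp]
        · rw [πd_neg _ hl]
          simp only [f]
          rw [if_pos ⟨trivial, k, (h.eqv_dom _ _ hk).1, (clsE _ _ (h.eqv_dom _ _ hk).1).2 hk⟩,
            h.app_rep hq hp]
      · rw [γd_neg _ hk, νd_neg _ (new_app d q p hq hk)]
        rcases split d p with ⟨l, rfl⟩ | hl
        · rw [πd_pos]
          simp only [f]
          -- A new class reads an old point through `t` if the point lies in `b`. This does not
          -- disturb `d`, since a point common to `b` and `d` is fixed by `t`, by `meet_eq`.
          have : (if d l ∈ Set.range b then t (d l) else d l) = d l := by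
            split_ifs with hlb
            · obtain ⟨k', hk'⟩ := hlb
              rcases meet_eq l with ⟨h1, h2⟩ | ⟨_, h2⟩
              · rw [← h2, ht, h1, h2]
              · exact absurd hk' (h2 k')
            · rfl
          rw [this, h.app_rep hq hp]
        · rw [πd_neg _ hl]
          simp only [f]
          rw [h.app_rep hq hp]
  obtain ⟨gb, b1, b2⟩ : ∃ g : N ↪[lang] Frame f, (∀ p, IsP p → g p = Frame.point (πb p)) ∧
      ∀ q, ¬ IsP q → g q = Frame.elt (γb q) (νb q) := by
    refine Frame.exists_embedding h πb γb νb ?_ ?_ ?_ ?_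
    · intro p p' _ _ hp
      rcases split b₀ p with ⟨k, rfl⟩ | hk <;> rcases split b₀ p' with ⟨k', rfl⟩ | hk'
      · rw [πb_pos, πb_pos] at hp; exact (b_eq _ _).2 (Sum.inl_injective hp)
      · rw [πb_pos, πb_neg _ hk'] at hp; cases hp
      · rw [πb_pos, πb_neg _ hk] at hp; cases hp
      · rw [πb_neg _ hk, πb_neg _ hk'] at hp; exact (Prod.ext_iff.1 (Sum.inr_injective hp)).1
    · intro q q' hq hq'
      rcases splitE b₀ q with ⟨k, hk⟩ | hk <;> rcases splitE b₀ q' with ⟨k', hk'⟩ | hk'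
      · have hbk : ¬ IsP (b k) := fun hb => (h.eqv_dom _ _ hk).1 ((b_isP k).2 hb)
        rw [γb_pos k q hk, γb_pos k' q' hk', Sum.inl_injective.eq_iff, clsE _ _ hbk, ← b_eqv]
        exact ⟨fun he => trans _ _ _ (symm _ _ hk) (trans _ _ _ he hk'),
          fun he => trans _ _ _ hk (trans _ _ _ he (symm _ _ hk'))⟩
      · rw [γb_pos k q hk, γb_neg _ hk']
        exact iff_of_false (by simp) fun he => hk' k (trans _ _ _ hk he)
      · rw [γb_pos k' q' hk', γb_neg _ hk]
        exact iff_of_false (by simp) fun he => hk k' (trans _ _ _ hk' (symm _ _ he))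
      · rw [γb_neg _ hk, γb_neg _ hk', Sum.inr_injective.eq_iff, clsE _ _ hq]
    · intro q q' _ hp
      rcases split b₀ q with ⟨k, rfl⟩ | hk <;> rcases split b₀ q' with ⟨k', rfl⟩ | hk'
      · rw [νb_pos, νb_pos] at hp; exact (b_eq _ _).2 (Sum.inl_injective hp)
      · rw [νb_pos, νb_neg _ hk'] at hp; cases hp
      · rw [νb_pos, νb_neg _ hk] at hp; cases hp
      · rw [νb_neg _ hk, νb_neg _ hk'] at hp; exact Sum.inr_injective hp
    · intro q p hq hp
      rcases splitE b₀ q with ⟨k, hk⟩ | hk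
      · have hbk : ¬ IsP (b k) := fun hb => (h.eqv_dom _ _ hk).1 ((b_isP k).2 hb)
        rw [γb_pos k q hk, ← h.app_congr hk hp]
        rcases split b₀ p with ⟨l, rfl⟩ | hl
        · rw [πb_pos, closed_b₀, νb_pos, ← closed_b]
          simp only [f]
          rw [h.app_rep hbk ((b_isP l).1 hp)]
        · rw [πb_neg _ hl]
          simp only [f]
          split_ifs with hc
          -- The only possible conflict: a coordinate of `x` at a class meeting both `b` and `d`. By
          -- `meet_eqv` this class also meets `b₀` at index `l`, and `x_app` makes the two
          -- prescriptions agree.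
          · obtain ⟨⟨i, rfl⟩, l, hdl, hl'⟩ := hc
            have hE := symm _ _ ((clsE _ _ hdl).1 hl')
            obtain ⟨h1, h2⟩ | ⟨_, h2⟩ := meet_eqv l
            swap
            · exact absurd hE (h2 k)
            have hb : Eqv (b₀ k) (b₀ l) := (b_eqv k l).2 (trans _ _ _ hE (symm _ _ h2))
            rw [h.app_rep hbk hp, h.app_congr hE hp, ← h.app_congr h1 hp, h.app_congr hb hp]
            rcases split b₀ (app (b₀ l) (x i)) with ⟨n, hn⟩ | hn
            · have hn' := (x_app i l n).1 hn.symm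
              rw [← h.app_congr h1 hp, ← hn] at hn'
              obtain ⟨-, h4⟩ | ⟨h4, -⟩ := meet_eq n
              · rw [← hn, νb_pos, hn', νd_pos, h4]
              · exact absurd hn' h4
            · rw [νb_neg _ hn, νd_neg]
              intro n hn'
              refine hn n ((x_app i l n).2 ?_).symm
              rw [hn', h.app_congr h1 hp]
          · rw [← h.app_congr (hr' k hbk) hp]
      · rw [γb_neg _ hk, νb_neg _ (new_app b₀ q p hq hk)]
        rcases split b₀ p with ⟨l, rfl⟩ | hl
        · rw [πb_pos]
          simp only [f]
          rw [if_pos ⟨l, rfl⟩, ht, h.app_rep hq hp]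
        · rw [πb_neg _ hl]
          simp only [f]
          rw [h.app_rep hq hp]
  refine ⟨Frame f, inferInstance, inferInstance, e, gd, gb, fun k => ?_, fun k => ?_, fun i => ?_⟩
  · by_cases hk : IsP (d k)
    · rw [d1 _ hk, e1 _ hk, πd_pos]
    · rw [d2 _ hk, e2 _ hk, νd_pos, γd_pos k _ (h.eqv_refl _ hk)]
  · by_cases hk : IsP (b₀ k)
    · rw [b1 _ hk, e1 _ ((b_isP k).1 hk), πb_pos]
    · rw [b2 _ hk, e2 _ (fun hb => hk ((b_isP k).2 hb)), νb_pos, γb_pos k _ (h.eqv_refl _ hk)]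
  · have key : ∀ k, b₀ k = x i → d k = x i ∧ b k = x i := fun k hk => by
      have hk' := (x_eq i k).1 hk.symm
      obtain ⟨-, h4⟩ | ⟨h4, -⟩ := meet_eq k
      · exact ⟨hk'.symm, by rw [h4, hk']⟩
      · exact absurd (hk.trans hk') h4
    have key' : (∀ k, b₀ k ≠ x i) → ∀ k, d k ≠ x i := fun hn k hk =>
      hn k ((x_eq i k).2 hk.symm).symm
    by_cases hi : IsP (x i)
    · rw [d1 _ hi, b1 _ hi]
      rcases split b₀ (x i) with ⟨k, hk⟩ | hn
      · obtain ⟨k1, k2⟩ := key k hk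
        rw [← k1, πd_pos, k1, ← hk, πb_pos, hk, k2]
      · rw [πb_neg _ hn, πd_neg _ (key' hn), eq_true (Set.mem_range_self i)]
    · rw [d2 _ hi, b2 _ hi]
      have hν : νd (x i) = νb (x i) := by
        rcases split b₀ (x i) with ⟨k, hk⟩ | hn
        · obtain ⟨k1, k2⟩ := key k hk
          rw [← k1, νd_pos, k1, ← hk, νb_pos, hk, k2]
        · rw [νb_neg _ hn, νd_neg _ (key' hn)]
      have hγ : γd (x i) = γb (x i) := by
        rcases splitE b₀ (x i) with ⟨k, hk⟩ | hn
        · have hk' := symm _ _ ((x_eqv i k).1 (symm _ _ hk))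
          rw [γb_pos k _ hk, γd_pos k _ hk']
          obtain ⟨-, h4⟩ | ⟨h4, -⟩ := meet_eqv k
          · rw [(clsE _ _ hi).2 (trans _ _ _ (symm _ _ hk') (symm _ _ h4))]
          · exact absurd (trans _ _ _ hk (symm _ _ hk')) h4
        · rw [γb_neg _ hn, γd_neg]
          exact fun k hk => hn k (symm _ _ ((x_eqv i k).2 (symm _ _ hk)))
      rw [hν, hγ]

end Feq

/-! ### Trees and model completions in general -/

section General

theorem exists_initialSegment_of_chain {α : Type*} [Inhabited α] (ξ : ℕ → List α)
    (hξ : ∀ i, ξ i <+: ξ (i + 1)) (hl : ∀ i, (ξ i).length < (ξ (i + 1)).length) :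
    ∃ ρ : ℕ → α, ∀ i, ξ i = initialSegment ρ (ξ i).length := by
  have hmono : ∀ i j, i ≤ j → ξ i <+: ξ j := fun i j hij => by
    induction j, hij using Nat.le_induction with
    | base => exact List.prefix_refl _
    | succ j _ ih => exact ih.trans (hξ j)
  have hlen : ∀ i, i ≤ (ξ i).length := fun i => by
    induction i with
    | zero => exact Nat.zero_le _
    | succ i ih => exact Nat.succ_le_of_lt (ih.trans_lt (hl i))
  -- Lengths increase strictly, so `ξ (n + 1)` has an n-th entry and the default is never used.
  refine ⟨fun n => (ξ (n + 1)).getD n default, fun i => ?_⟩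
  refine List.ext_getElem (by simp [initialSegment]) fun n h1 h2 => ?_
  have hn : n < (ξ (n + 1)).length := hlen (n + 1)
  simp only [initialSegment, List.getElem_ofFn, List.getD_eq_getElem _ _ hn]
  rcases le_total i (n + 1) with h | h
  · exact (hmono _ _ h).getElem h1
  · exact ((hmono _ _ h).getElem hn).symm

variable {L : FirstOrder.Language.{u, v}}

theorem consistentInstances_of_forall {M : Type*} [L.Structure M] {n m : ℕ}
    {φ : L.Formula (Fin n ⊕ Fin m)} {A : Set (Fin m → M)} (x : Fin n → M)
    (h : ∀ b ∈ A, φ.Realize (Sum.elim x b)) : ConsistentInstances φ A :=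
  fun _ hs => ⟨x, fun b hb => h b (hs hb)⟩

theorem ConsistentInstances.mono {M : Type*} [L.Structure M] {n m : ℕ}
    {φ : L.Formula (Fin n ⊕ Fin m)} {A B : Set (Fin m → M)} (h : ConsistentInstances φ B)
    (hAB : A ⊆ B) : ConsistentInstances φ A :=
  fun s hs => h s (hs.trans hAB)

/-- With `M` itself a model of T' and `f₁` the identity, this says that embeddings between models of
T' are elementary. -/
theorem IsModelCompletion.realize_iff {T T' : L.Theory} (hT : IsModelCompletion T T')
    {M N₁ N₂ : Type max u v} [L.Structure M] [L.Structure N₁] [L.Structure N₂] [Nonempty M]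
    [M ⊨ T] [N₁ ⊨ T'] [N₂ ⊨ T'] (f₁ : M ↪[L] N₁) (f₂ : M ↪[L] N₂) {α : Type*} [Finite α]
    (φ : L.Formula α) (c : α → M) : φ.Realize (f₁ ∘ c) ↔ φ.Realize (f₂ ∘ c) := by
  obtain ⟨n, ⟨e⟩⟩ := Finite.exists_equiv_fin α
  have : Nonempty N₁ := ⟨f₁ (Classical.arbitrary M)⟩
  have : Nonempty N₂ := ⟨f₂ (Classical.arbitrary M)⟩
  have key := hT.diagram_complete (.of T M) (.of T' N₁) (.of T' N₂) f₁ f₂ n (φ.relabel e)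
    (c ∘ e.symm)
  have e₁ : c = (c ∘ e.symm) ∘ e := by funext i; simp
  rw [e₁]
  exact (Formula.realize_relabel (v := f₁ ∘ c ∘ e.symm)).symm.trans
    (key.trans (Formula.realize_relabel (v := f₂ ∘ c ∘ e.symm)))

theorem IsModelCompletion.models {T T' : L.Theory} (hT : IsModelCompletion T T')
    (N : Type max u v) [L.Structure N] [Nonempty N] [N ⊨ T'] : N ⊨ T :=
  T.model_iff.2 fun φ hφ =>
    Theory.models_sentence_iff.1 (hT.extends_base φ hφ) (.of T' N)

end General

/-! ### Ultrafilter limits of sequences of tuples -/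

section Ultrafilter

open Filter

theorem exists_eventually_eq {κ : Type*} [Finite κ] (U : Ultrafilter ℕ) (col : ℕ → κ) :
    ∃ c, ∀ᶠ n in U, col n = c := by
  by_contra hc
  rw [not_exists] at hc
  have h1 : ∀ᶠ n in (U : Filter ℕ), ∀ c, ¬ col n = c :=
    eventually_all.2 fun c => Ultrafilter.eventually_not.2 (hc c)
  obtain ⟨n, hn⟩ := h1.exists
  exact hn _ rfl

/-- For fixed l, either most pairs c_h(l), c_i(l) are related, or most are not. In the first case a
single c_h(l) is related to c_i(l) and c_j(l), and by `hc` to c'_i(l). In the second, no fixed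
c'_i(k) can be related to most c_j(l), as two unrelated ones among them would become related. -/
theorem eventually_meet {N κ : Type*} [Finite κ] (r : N → N → Prop)
    (symm : ∀ x y, r x y → r y x) (trans : ∀ x y z, r x y → r y z → r x z)
    (c c' : ℕ → κ → N) (hc : ∀ h i l, h < i → r (c h l) (c i l) → r (c h l) (c' i l)) :
    ∀ᶠ i in (hyperfilter ℕ : Filter ℕ), ∀ᶠ j in (hyperfilter ℕ : Filter ℕ), ∀ l,
      (r (c i l) (c j l) ∧ r (c' i l) (c j l)) ∨
        (¬ r (c i l) (c j l) ∧ ∀ k, ¬ r (c' i k) (c j l)) := by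
  have hgt : ∀ h, ∀ᶠ i in (hyperfilter ℕ : Filter ℕ), h < i := fun h =>
    (eventually_gt_atTop h).filter_mono Nat.hyperfilter_le_atTop
  suffices H : ∀ l, ∀ᶠ i in (hyperfilter ℕ : Filter ℕ), ∀ᶠ j in (hyperfilter ℕ : Filter ℕ),
      (r (c i l) (c j l) ∧ r (c' i l) (c j l)) ∨
        (¬ r (c i l) (c j l) ∧ ∀ k, ¬ r (c' i k) (c j l)) by
    filter_upwards [eventually_all.2 H] with i hi
    exact eventually_all.2 hi
  intro l
  by_cases hA : ∀ᶠ h in (hyperfilter ℕ : Filter ℕ), ∀ᶠ i in (hyperfilter ℕ : Filter ℕ),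
      r (c h l) (c i l)
  · obtain ⟨h, hh⟩ := hA.exists
    filter_upwards [hh, hgt h] with i hi hhi
    filter_upwards [hh] with j hj
    exact Or.inl ⟨trans _ _ _ (symm _ _ hi) hj, trans _ _ _ (symm _ _ (hc h i l hhi hi)) hj⟩
  · have hB : ∀ᶠ h in (hyperfilter ℕ : Filter ℕ), ∀ᶠ i in (hyperfilter ℕ : Filter ℕ),
        ¬ r (c h l) (c i l) := by
      simpa only [Ultrafilter.eventually_not] using Ultrafilter.eventually_not.2 hA
    filter_upwards [hB] with i hi
    have hk : ∀ k, ∀ᶠ j in (hyperfilter ℕ : Filter ℕ), ¬ r (c' i k) (c j l) := by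
      intro k
      rw [Ultrafilter.eventually_not]
      intro hk
      obtain ⟨j, hj, hj'⟩ := (hk.and hB).exists
      obtain ⟨j', h1, h2⟩ := (hk.and hj').exists
      exact h2 (trans _ _ _ (symm _ _ hj) h1)
    filter_upwards [hi, eventually_all.2 hk] with j h1 h2
    exact Or.inr ⟨h1, h2⟩

end Ultrafilter

/-! ### Model completions of `T_feq` do not have `SOP₁` -/

namespace Feq

open Filter

section Pairs

variable {N : Type*} [lang.Structure N] {κ : Type*}

/-- The values of `F` on pairs of members of a tuple. -/
def pairs (c : κ → N) (kl : κ × κ) : N := app (c kl.1) (c kl.2)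

theorem Axioms.isP_pairs (h : Axioms N) (c : κ → N) (a : κ × κ) :
    IsP (pairs c a) ↔ IsP (c a.1) := h.isP_app _ _

theorem Axioms.pairs_self (h : Axioms N) (c : κ → N) (k : κ) : pairs c (k, k) = c k :=
  h.app_self _

open Classical in
/-- The function computing `F` on `pairs c` from the set of indices `k` with `c k` in `P`. -/
noncomputable def pairIndex (p : κ → Prop) (a b : κ × κ) : κ × κ :=
  if p b.1 ∧ ¬ p a.1 then (a.1, b.1) else a

/-- F fixes P and F(F(x,z),w) = F(x,w) for w in P, so one application of F already closes a tuple.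
The resulting index depends only on which coordinates lie in P, hence is the same for tuples that
agree there. -/
theorem Axioms.app_pairs (h : Axioms N) (c : κ → N) (p : κ → Prop) (hp : ∀ k, p k ↔ IsP (c k))
    (a b : κ × κ) : app (pairs c a) (pairs c b) = pairs c (pairIndex p a b) := by
  unfold pairIndex
  split_ifs with hab
  · have hb : pairs c b = c b.1 := h.app_out _ _ (Or.inl ((hp _).1 hab.1))
    rw [hb]
    exact h.app_app (fun ha => hab.2 ((hp _).2 ha)) ((hp _).1 hab.1)
  · refine h.app_out _ _ ?_
    rw [h.isP_pairs, h.isP_pairs, ← hp, ← hp]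
    tauto

end Pairs

/-- An instance of `φ` over `d` and one over `b` have a common solution, under the hypotheses of
independent amalgamation. -/
theorem exists_common_realization {T' : lang.Theory} (hT : IsModelCompletion theory T')
    {M : Type} [lang.Structure M] [M ⊨ T'] {n m : ℕ} (φ : lang.Formula (Fin n ⊕ Fin m))
    (b₀ b d : Fin m → M) (x : Fin n → M)
    (b_isP : ∀ k, IsP (b₀ k) ↔ IsP (b k))
    (b_eq : ∀ k l, pairs b₀ k = pairs b₀ l ↔ pairs b k = pairs b l)
    (b_eqv : ∀ k l, Eqv (pairs b₀ k) (pairs b₀ l) ↔ Eqv (pairs b k) (pairs b l))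
    (meet_eq : ∀ l, (pairs b₀ l = pairs d l ∧ pairs b l = pairs d l) ∨
      (pairs b₀ l ≠ pairs d l ∧ ∀ k, pairs b k ≠ pairs d l))
    (meet_eqv : ∀ l, (Eqv (pairs b₀ l) (pairs d l) ∧ Eqv (pairs b l) (pairs d l)) ∨
      (¬ Eqv (pairs b₀ l) (pairs d l) ∧ ∀ k, ¬ Eqv (pairs b k) (pairs d l)))
    (x_eq : ∀ s k, x s = pairs b₀ k ↔ x s = pairs d k)
    (x_eqv : ∀ s k, Eqv (x s) (pairs b₀ k) ↔ Eqv (x s) (pairs d k))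
    (x_app : ∀ s k n, app (pairs b₀ k) (x s) = pairs b₀ n ↔ app (pairs d k) (x s) = pairs d n)
    (hb₀ : φ.Realize (Sum.elim x b₀)) (hd : φ.Realize (Sum.elim x d)) :
    ∃ y : Fin n → M, φ.Realize (Sum.elim y b) ∧ φ.Realize (Sum.elim y d) := by
  rcases isEmpty_or_nonempty M with hM | hM
  · cases isEmpty_or_nonempty (Fin m) with
    | inl hm =>
      rw [Subsingleton.elim b₀ b] at hb₀
      exact ⟨x, hb₀, hd⟩
    | inr hm => exact (hM.false (b (Classical.arbitrary _))).elim
  have := hT.models M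
  have h := axioms_of_model M
  obtain ⟨N', _, _, e, gd, gb, h1, h2, h3⟩ := exists_amalgam h (pairs b₀) (pairs b) (pairs d) x
    (pairIndex fun k => IsP (b₀ k)) (pairIndex fun k => IsP (d k))
    (h.app_pairs _ _ fun _ => Iff.rfl) (h.app_pairs _ _ fun k => b_isP k)
    (h.app_pairs _ _ fun _ => Iff.rfl) b_eq
    (fun k => by rw [h.isP_pairs, h.isP_pairs]; exact b_isP _) b_eqv meet_eq meet_eqv x_eq x_eqv
    x_app
  have : Nonempty N' := ⟨e (Classical.arbitrary M)⟩
  obtain ⟨N, ⟨g⟩⟩ := hT.embeds (.of theory N')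
  have g : N' ↪[lang] N := g
  let ψ : lang.Formula (Fin m ⊕ Fin m) := Formula.iExs (Fin n)
    (φ.relabel (Sum.elim Sum.inr (Sum.inl ∘ Sum.inl)) ⊓
      φ.relabel (Sum.elim Sum.inr (Sum.inl ∘ Sum.inr)))
  have hψ : ∀ (K : Type) [lang.Structure K] (u w : Fin m → K), ψ.Realize (Sum.elim u w) ↔
      ∃ y : Fin n → K, φ.Realize (Sum.elim y u) ∧ φ.Realize (Sum.elim y w) := by
    intro K _ u w
    simp only [ψ, Formula.realize_iExs, Formula.realize_inf, Formula.realize_relabel,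
      Sum.comp_elim, Sum.elim_comp_inr, ← Function.comp_assoc, Sum.elim_comp_inl]
  -- All of `g ∘ e`, `g ∘ gb`, `g ∘ gd` are elementary. Through `gb` the solution `x` over `b₀`
  -- becomes one over the copy of `b`, through `gd` it stays one over `d`, and both images of `x`
  -- coincide; `e` brings the existential statement back to `M`.
  have e₁ := hT.realize_iff (Embedding.refl lang M) (g.comp e) ψ (Sum.elim b d)
  rw [Sum.comp_elim, Sum.comp_elim, hψ, hψ] at e₁
  refine e₁.2 ⟨g ∘ gd ∘ x, ?_, ?_⟩
  · have e₂ := hT.realize_iff (Embedding.refl lang M) (g.comp gb) φ (Sum.elim x b₀)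
    convert e₂.1 hb₀ using 1
    rw [Sum.comp_elim]
    congr 1
    · funext s; simp [h3]
    · funext k
      have := h2 (k, k)
      rw [h.pairs_self, h.pairs_self] at this
      simp [this]
  · have e₂ := hT.realize_iff (Embedding.refl lang M) (g.comp gd) φ (Sum.elim x d)
    convert e₂.1 hd using 1
    rw [Sum.comp_elim]
    congr 1
    funext k
    have := h1 (k, k)
    rw [h.pairs_self] at this
    simp [this]

/-- In a tree exemplifying `SOP₁` in a model of `T_feq` there is a sequence `c` along a branch and
a sequence `c'` off the branch such that `c' i` looks like `c i` over the preceding members of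
`c`. -/
theorem exists_parallel_sequences {M : Type} [lang.Structure M] {n m : ℕ}
    {φ : lang.Formula (Fin n ⊕ Fin m)} {a : List Bool → Fin m → M} (ha : ExemplifiesSOP1 φ a) :
    ∃ c c' : ℕ → Fin m → M,
      (∀ N : ℕ, ∃ x : Fin n → M, ∀ i < N, φ.Realize (Sum.elim x (c i))) ∧
      (∀ i j, i < j → ¬ ConsistentInstances φ {c j, c' i}) ∧
      (∀ i k, IsP (c i k) ↔ IsP (c' i k)) ∧
      (∀ i k l, pairs (c i) k = pairs (c i) l ↔ pairs (c' i) k = pairs (c' i) l) ∧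
      (∀ i k l, Eqv (pairs (c i) k) (pairs (c i) l) ↔ Eqv (pairs (c' i) k) (pairs (c' i) l)) ∧
      (∀ h i l, h < i → (pairs (c h) l = pairs (c i) l ↔ pairs (c h) l = pairs (c' i) l)) ∧
      (∀ h i l, h < i →
        (Eqv (pairs (c h) l) (pairs (c i) l) ↔ Eqv (pairs (c h) l) (pairs (c' i) l))) := by
  let K := Fin m × Fin m
  let nd : List Bool → ℕ → List Bool := fun ξ j => ξ ++ List.replicate j false ++ [true]
  -- The colour records the quantifier-free type of `c` and its coordinatewise coincidences, under
  -- equality and E, with the tuples at all initial segments of `ξ`, including `ξ` itself. There are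
  -- finitely many colours.
  let col : (ξ : List Bool) → (Fin m → M) → (Fin m → Prop) × (K → K → Prop × Prop) ×
      (Fin (ξ.length + 1) → K → Prop × Prop) := fun ξ c =>
    (fun k => IsP (c k), fun k l => (pairs c k = pairs c l, Eqv (pairs c k) (pairs c l)),
      fun r l => (pairs (a (ξ.take r)) l = pairs c l, Eqv (pairs (a (ξ.take r)) l) (pairs c l)))
  have step : ∀ ξ, ∃ j j', j < j' ∧ col ξ (a (nd ξ j')) = col ξ (a (nd ξ j)) := by
    intro ξ
    -- Among the infinitely many nodes ξ⌢0^j⌢1 two have the same colour. The branch continues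
    -- through the one with more zeros; the other supplies `c'`.
    obtain ⟨j, j', hne, he⟩ :=
      Finite.exists_ne_map_eq_of_infinite fun j => col ξ (a (nd ξ j))
    rcases lt_or_gt_of_ne hne with hlt | hlt
    exacts [⟨j, j', hlt, he.symm⟩, ⟨j', j, hlt, he⟩]
  choose J J' hJ hcol using step
  let ξ : ℕ → List Bool := fun i => Nat.rec [] (fun _ ζ => nd ζ (J' ζ)) i
  have ξs : ∀ i, ξ (i + 1) = nd (ξ i) (J' (ξ i)) := fun _ => rfl
  have ξpre : ∀ i, ξ i <+: ξ (i + 1) := fun i => by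
    simp only [ξs, nd, List.append_assoc]; exact List.prefix_append _ _
  have ξlen : ∀ i, (ξ i).length < (ξ (i + 1)).length := fun i => by
    simp only [ξs, nd, List.length_append, List.length_singleton]; omega
  have ξmono : ∀ i j, i ≤ j → ξ i <+: ξ j := fun i j hij => by
    induction j, hij using Nat.le_induction with
    | base => exact List.prefix_refl _
    | succ j _ ih => exact ih.trans (ξpre j)
  have hcol' : ∀ i, col (ξ i) (a (ξ (i + 1))) = col (ξ i) (a (nd (ξ i) (J (ξ i)))) :=
    fun i => hcol _
  simp only [col, Prod.mk.injEq, funext_iff, eq_iff_iff] at hcol'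
  have hpast : ∀ h i, h < i → ∃ r : Fin ((ξ i).length + 1), (ξ i).take r = ξ (h + 1) :=
    fun h i hi => ⟨⟨(ξ (h + 1)).length, Nat.lt_succ_of_le (ξmono _ _ hi).length_le⟩,
      (List.prefix_iff_eq_take.1 (ξmono _ _ hi)).symm⟩
  refine ⟨fun i => a (ξ (i + 1)), fun i => a (nd (ξ i) (J (ξ i))), ?_, ?_,
    fun i => (hcol' i).1, fun i k l => ((hcol' i).2.1 k l).1, fun i k l => ((hcol' i).2.1 k l).2,
    ?_, ?_⟩
  · obtain ⟨ρ, hρ⟩ := exists_initialSegment_of_chain ξ ξpre ξlen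
    intro N
    classical
    obtain ⟨x, hx⟩ := ha.branch_consistent ρ
      ((Finset.range N).image fun i => a (ξ (i + 1))) (by
        intro b hb
        simp only [Finset.coe_image, Set.mem_image] at hb
        obtain ⟨i, -, rfl⟩ := hb
        exact ⟨_, congrArg a (hρ (i + 1)).symm⟩)
    exact ⟨x, fun i hi => hx _ (Finset.mem_image_of_mem _ (Finset.mem_range.2 hi))⟩
  · intro i j hij
    -- With ν = ξ_i⌢0^J, the tuple `c' i` sits at ν⌢1, while all later nodes of the branch extend
    -- ν⌢0 because J < J'.
    have := ha.pair_inconsistent (ξ i ++ List.replicate (J (ξ i)) false) (ξ (j + 1)) ?_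
    · exact this
    · refine List.IsPrefix.trans ?_ (ξmono (i + 1) (j + 1) (by omega))
      rw [ξs]
      obtain ⟨r, hr⟩ := Nat.exists_eq_add_of_lt (hJ (ξ i))
      refine ⟨List.replicate r false ++ [true], ?_⟩
      simp only [nd]
      have : List.replicate (J' (ξ i)) false = List.replicate (J (ξ i)) false ++ [false] ++
          List.replicate r false := by
        rw [← List.replicate_succ', ← List.replicate_add]
        congr 1
        omega
      rw [this]
      simp only [List.append_assoc]
  · intro h i l hi
    obtain ⟨r, hr⟩ := hpast h i hi
    have := ((hcol' i).2.2 r l).1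
    rwa [hr] at this
  · intro h i l hi
    obtain ⟨r, hr⟩ := hpast h i hi
    have := ((hcol' i).2.2 r l).2
    rwa [hr] at this

theorem not_hasSOP1 {T' : lang.Theory} (hT : IsModelCompletion theory T') : ¬ HasSOP1 T' := by
  rintro ⟨M, n, m, φ, a, ha⟩
  have := hT.models M
  have h := axioms_of_model M
  obtain ⟨c, c', hx, hinc, hP, heq, heqv, hpeq, hpeqv⟩ := exists_parallel_sequences ha
  choose x hx using hx
  -- The relations of the solution `x N` to `c i`. Taking the limit colour first in N and then in i
  -- provides i < j < N with equal colours.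
  let col : ℕ → ℕ → (Fin n → Fin m × Fin m → Prop) × (Fin n → Fin m × Fin m → Prop) ×
      (Fin n → Fin m × Fin m → Fin m × Fin m → Prop) := fun i N =>
    (fun s k => x N s = pairs (c i) k, fun s k => Eqv (x N s) (pairs (c i) k),
      fun s k l => app (pairs (c i) k) (x N s) = pairs (c i) l)
  choose κ hκ using fun i => exists_eventually_eq (hyperfilter ℕ) (col i)
  obtain ⟨κ₀, hκ₀⟩ := exists_eventually_eq (hyperfilter ℕ) κ
  have hgt : ∀ i, ∀ᶠ j in (hyperfilter ℕ : Filter ℕ), i < j := fun i =>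
    (eventually_gt_atTop i).filter_mono Nat.hyperfilter_le_atTop
  obtain ⟨i, hi, m1, m2⟩ := (hκ₀.and
    ((eventually_meet (· = ·) (fun _ _ => Eq.symm) (fun _ _ _ => Eq.trans)
      (fun i => pairs (c i)) (fun i => pairs (c' i)) fun h i l hi => (hpeq h i l hi).1).and
    (eventually_meet Eqv h.eqv_symm h.eqv_trans
      (fun i => pairs (c i)) (fun i => pairs (c' i)) fun h i l hi => (hpeqv h i l hi).1))).exists
  obtain ⟨j, hj, m1, m2, hij⟩ := (hκ₀.and (m1.and (m2.and (hgt i)))).exists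
  obtain ⟨N, hiN, hjN, hN⟩ := ((hκ i).and ((hκ j).and (hgt j))).exists
  have hc : col i N = col j N := by rw [hiN, hjN, hi, hj]
  simp only [col, Prod.mk.injEq, funext_iff, eq_iff_iff] at hc
  obtain ⟨y, hy, hy'⟩ := exists_common_realization hT φ (c i) (c' i) (c j) (x N) (hP i) (heq i)
    (heqv i) m1 m2 hc.1 hc.2.1 hc.2.2 (hx N i (hij.trans hN)) (hx N j hN)
  refine hinc i j hij (consistentInstances_of_forall y ?_)
  rintro b (rfl | rfl)
  exacts [hy', hy]

end Feq

/-! ### `SOP₁` implies the tree property -/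

theorem initialSegment_succ {α : Type*} (σ : ℕ → α) (l : ℕ) :
    initialSegment σ (l + 1) = initialSegment σ l ++ [σ l] := by
  rw [initialSegment, List.ofFn_succ', List.concat_eq_append]
  simp [initialSegment]

/-- The i-th successor of ξ is taken to be ξ⌢0^i⌢1. For i < j the j-th successor extends ξ⌢0^i⌢0, so
siblings are pairwise inconsistent, and ω-branches run along binary branches. -/
theorem ExemplifiesSOP1.exists_treeProperty {L : FirstOrder.Language.{u, v}} {M : Type*}
    [L.Structure M] {n m : ℕ} {φ : L.Formula (Fin n ⊕ Fin m)} {a : List Bool → Fin m → M}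
    (ha : ExemplifiesSOP1 φ a) :
    ∃ a' : List ℕ → Fin m → M, ExemplifiesTreeProperty φ 2 a' := by
  let nd : List Bool → ℕ → List Bool := fun ξ i => ξ ++ List.replicate i false ++ [true]
  let t : List ℕ → List Bool := fun η => η.foldl nd []
  have ht : ∀ η i, t (η ++ [i]) = nd (t η) i := fun η i => by simp [t, List.foldl_append]
  have hinc : ∀ ξ i j, i < j → ¬ ConsistentInstances φ {a (nd ξ j), a (nd ξ i)} := by
    intro ξ i j hij
    refine ha.pair_inconsistent (ξ ++ List.replicate i false) _ ?_
    obtain ⟨r, rfl⟩ := Nat.exists_eq_add_of_lt hij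
    refine ⟨List.replicate r false ++ [true], ?_⟩
    simp only [nd]
    rw [show i + r + 1 = (i + 1) + r by omega, List.replicate_add, List.replicate_succ']
    simp only [List.append_assoc]
  refine ⟨fun η => a (t η), fun σ => ?_, fun η I hI => ?_⟩
  · obtain ⟨ρ, hρ⟩ := exists_initialSegment_of_chain (fun l => t (initialSegment σ l))
      (fun l => by
        rw [initialSegment_succ, ht]
        simp only [nd, List.append_assoc]
        exact List.prefix_append _ _)
      (fun l => by
        rw [initialSegment_succ, ht]
        simp only [nd, List.length_append, List.length_singleton]
        omega)
    refine (ha.branch_consistent ρ).mono ?_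
    rintro _ ⟨l, rfl⟩
    exact ⟨_, congrArg a (hρ l).symm⟩
  · obtain ⟨i, j, hij, rfl⟩ := Finset.card_eq_two.1 hI
    simp only [Finset.coe_insert, Finset.coe_singleton, Set.image_pair, ht]
    rcases lt_or_gt_of_ne hij with hlt | hlt
    · rw [Set.pair_comm]; exact hinc _ _ _ hlt
    · exact hinc _ _ _ hlt

theorem IsSimpleTheory.not_hasSOP1 {L : FirstOrder.Language.{u, v}} {T : L.Theory}
    (hT : IsSimpleTheory T) : ¬ HasSOP1 T := by
  rintro ⟨M, n, m, φ, a, ha⟩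
  obtain ⟨a', ha'⟩ := ha.exists_treeProperty
  exact hT ⟨M, n, m, φ, 2, a', ha'⟩

namespace Feq

/-! ### A model completion of `T_feq` is complete and not simple -/

/-- The formula `y R x`. -/
def incFormula : lang.Formula (Fin 1 ⊕ Fin 1) :=
  symR.formula₂ (Term.var (Sum.inr 0)) (Term.var (Sum.inl 0))

theorem realize_incFormula {N : Type*} [lang.Structure N] (x y : Fin 1 → N) :
    incFormula.Realize (Sum.elim x y) ↔ Inc (y 0) (x 0) := by
  simp only [incFormula, Formula.realize_rel₂, Term.realize_var, Sum.elim_inl, Sum.elim_inr]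
  rfl

theorem embedding_inc {N N' : Type*} [lang.Structure N] [lang.Structure N'] (g : N ↪[lang] N')
    (x z : N) : Inc (g x) (g z) ↔ Inc x z := by
  have := g.map_rel symR ![x, z]
  rwa [show g ∘ ![x, z] = ![g x, g z] by ext i; fin_cases i <;> rfl] at this

theorem embedding_eqv {N N' : Type*} [lang.Structure N] [lang.Structure N'] (g : N ↪[lang] N')
    (x z : N) : Eqv (g x) (g z) ↔ Eqv x z := by
  have := g.map_rel symE ![x, z]
  rwa [show g ∘ ![x, z] = ![g x, g z] by ext i; fin_cases i <;> rfl] at this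

/-- Siblings are distinct elements of one class, so no point is R-related to two of them; different
families of siblings occupy different classes, in which a point may choose independently. -/
theorem not_isSimpleTheory {T' : lang.Theory} (hT : IsModelCompletion theory T') :
    ¬ IsSimpleTheory T' := by
  let f : List ℕ → (List ℕ → ℕ) → ℕ := fun c p => p c
  have : Nonempty (Frame f) := ⟨Frame.point fun _ => 0⟩
  obtain ⟨N, ⟨g⟩⟩ := hT.embeds (.of theory (Frame f))
  have g : Frame f ↪[lang] N := g
  have hN : Axioms N := @axioms_of_model N _ (hT.models N)
  -- the class of the root differs from those of the other nodes
  let node : List ℕ → Frame f := fun η =>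
    Frame.elt (if η = [] then [] else 0 :: η.dropLast) (η.getLastD 0)
  intro h
  refine h ⟨N, 1, 1, incFormula, 2, fun η _ => g (node η), fun σ => ?_, fun η I hI hcon => ?_⟩
  · refine consistentInstances_of_forall
      -- The class of a node of length l + 1 is a list of the same length, whence the shift: the
      -- point selects σ(l), the last entry of that node.
      (fun _ => g (Frame.point fun η => if η = [] then 0 else σ (η.length - 1))) ?_
    rintro _ ⟨l, rfl⟩
    rw [realize_incFormula, embedding_inc, Frame.inc_iff]
    refine ⟨if initialSegment σ l = [] then [] else 0 :: (initialSegment σ l).dropLast, _, ?_, rfl⟩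
    rw [Frame.elt_inj]
    refine ⟨rfl, ?_⟩
    rcases l with _ | l
    · simp [initialSegment, f]
    · rw [initialSegment_succ]
      simp [initialSegment, f]
  · obtain ⟨i, j, hij, rfl⟩ := Finset.card_eq_two.1 hI
    classical
    obtain ⟨x, hx⟩ := hcon {fun _ => g (node (η ++ [i])), fun _ => g (node (η ++ [j]))}
      (by simp [Set.image_pair])
    have h1 := hx (fun _ => g (node (η ++ [i]))) (by simp)
    have h2 := hx (fun _ => g (node (η ++ [j]))) (by simp)
    rw [realize_incFormula] at h1 h2
    have := hN.inc_unique _ _ _ h1 h2 (by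
      rw [embedding_eqv]
      simp only [node, List.append_ne_nil_of_right_ne_nil _ (List.cons_ne_nil _ _), if_false,
        List.dropLast_concat]
      exact Frame.eqv_elt.2 rfl)
    have := g.injective this
    simp only [node, Frame.elt_inj] at this
    simp at this
    exact hij this

/-- A new point can always be added, with arbitrary values of F. The existence of a point then holds
in a model of T' extending N, hence in N. -/
theorem exists_isP_of_model {T' : lang.Theory} (hT : IsModelCompletion theory T')
    (N : Type) [lang.Structure N] [Nonempty N] [N ⊨ T'] : ∃ p : N, IsP p := by
  have := hT.models N
  have h := axioms_of_model N
  let f : h.Cls → N ⊕ Unit → N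
    | c, Sum.inl p => app (h.rep c) p
    | c, Sum.inr _ => h.rep c
  obtain ⟨e, -, -⟩ := Frame.exists_embedding (f := f) h Sum.inl h.cls id
    (fun _ _ _ _ hp => Sum.inl_injective hp) (fun _ _ hq _ => h.cls_eq_iff hq)
    (fun _ _ _ hq => hq) (fun _ _ hq hp => h.app_rep hq hp)
  have : Nonempty (Frame f) := ⟨Frame.point (Sum.inr ())⟩
  obtain ⟨N', ⟨g⟩⟩ := hT.embeds (.of theory (Frame f))
  have g : Frame f ↪[lang] N' := g
  let ψ : lang.Formula (Fin 0) :=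
    Formula.iExs (Fin 1) (symP.formula₁ (Term.var (Sum.inr 0)))
  have hψ : ∀ (K : Type) [lang.Structure K] (w : Fin 0 → K), ψ.Realize w ↔ ∃ p : K, IsP p := by
    intro K _ w
    simp only [ψ, Formula.realize_iExs, Formula.realize_rel₁, Term.realize_var, Sum.elim_inr]
    exact ⟨fun ⟨i, hi⟩ => ⟨i 0, hi⟩, fun ⟨p, hp⟩ => ⟨fun _ => p, hp⟩⟩
  have := hT.realize_iff (Embedding.refl lang N) (g.comp e) ψ Fin.elim0
  rw [hψ, hψ] at this
  exact this.2 ⟨g (Frame.point (Sum.inr ())), (embedding_isP g _).2 (Frame.isP_point _)⟩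

theorem isComplete {T' : lang.Theory} (hT : IsModelCompletion theory T') : T'.IsComplete := by
  -- The model with one point and no classes. It is a common nonempty submodel, needed because
  -- `IsModelCompletion` compares completions over nonempty models only.
  let f : Empty → Unit → Unit := fun _ _ => ()
  have : Nonempty (Frame f) := ⟨Frame.point ()⟩
  have hf : ∀ x : Frame f, x = Frame.point () := by
    rintro (x | ⟨⟨⟩, -⟩)
    rfl
  obtain ⟨N₀, -⟩ := hT.embeds (.of theory (Frame f))
  have emb : ∀ (N : Type) [lang.Structure N] [Nonempty N] [N ⊨ T'],
      Nonempty (Frame f ↪[lang] N) := by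
    intro N _ _ _
    have := hT.models N
    obtain ⟨p, hp⟩ := exists_isP_of_model hT N
    have h := axioms_of_model N
    refine ⟨embeddingOfMap (Frame.axioms f) h (fun _ => p) (fun x y _ => by rw [hf x, hf y])
      (fun x => by rw [hf x]; simpa) (fun x y => ?_) (fun x z => ?_)⟩
    · exact iff_of_false (fun he => (h.eqv_dom _ _ he).1 hp)
        (fun he => ((Frame.axioms f).eqv_dom _ _ he).1 (by rw [hf x]; simp))
    · exact (h.app_out p p (Or.inl hp)).symm
  have agree : ∀ (N₁ N₂ : Theory.ModelType.{0, 0, 0} T') (φ : lang.Sentence),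
      N₁ ⊨ φ ↔ N₂ ⊨ φ := by
    intro N₁ N₂ φ
    obtain ⟨g₁⟩ := emb N₁
    obtain ⟨g₂⟩ := emb N₂
    have := hT.realize_iff g₁ g₂ φ Empty.elim
    rwa [Subsingleton.elim (g₁ ∘ Empty.elim) default,
      Subsingleton.elim (g₂ ∘ Empty.elim) default] at this
  refine ⟨Theory.Model.isSatisfiable N₀, fun φ => ?_⟩
  by_cases hφ : N₀ ⊨ φ
  · exact Or.inl (Theory.models_sentence_iff.2 fun N => (agree N₀ N φ).1 hφ)
  · refine Or.inr (Theory.models_sentence_iff.2 fun N => ?_)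
    rw [Sentence.realize_not]
    exact fun hN => hφ ((agree N₀ N φ).2 hN)

/-! ### Quantifier-free types of finite tuples -/

theorem embedding_app {N N' : Type*} [lang.Structure N] [lang.Structure N'] (g : N ↪[lang] N')
    (x z : N) : g (app x z) = app (g x) (g z) := by
  have := g.map_fun symF ![x, z]
  rwa [show g ∘ ![x, z] = ![g x, g z] by ext i; fin_cases i <;> rfl] at this

theorem vec1_eta {N : Type*} (xs : Fin 1 → N) : xs = ![xs 0] := by
  ext i; fin_cases i; rfl

theorem vec2_eta {N : Type*} (xs : Fin 2 → N) : xs = ![xs 0, xs 1] := by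
  ext i; fin_cases i <;> rfl

section SameType

variable {N₁ N₂ N₃ κ : Type*} [lang.Structure N₁] [lang.Structure N₂] [lang.Structure N₃]

/-- Two tuples have the same quantifier-free type. -/
structure SameType (w₁ : κ → N₁) (w₂ : κ → N₂) : Prop where
  isP : ∀ k, IsP (w₁ k) ↔ IsP (w₂ k)
  eqv : ∀ k l, Eqv (w₁ k) (w₁ l) ↔ Eqv (w₂ k) (w₂ l)
  eq : ∀ a b, pairs w₁ a = pairs w₁ b ↔ pairs w₂ a = pairs w₂ b

theorem SameType.symm {w₁ : κ → N₁} {w₂ : κ → N₂} (h : SameType w₁ w₂) : SameType w₂ w₁ :=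
  ⟨fun k => (h.isP k).symm, fun k l => (h.eqv k l).symm, fun a b => (h.eq a b).symm⟩

theorem SameType.trans {w₁ : κ → N₁} {w₂ : κ → N₂} {w₃ : κ → N₃} (h : SameType w₁ w₂)
    (h' : SameType w₂ w₃) : SameType w₁ w₃ :=
  ⟨fun k => (h.isP k).trans (h'.isP k), fun k l => (h.eqv k l).trans (h'.eqv k l),
    fun a b => (h.eq a b).trans (h'.eq a b)⟩

theorem SameType.comp {w₁ : κ → N₁} {w₂ : κ → N₂} (h : SameType w₁ w₂) {κ' : Type*}
    (r : κ' → κ) : SameType (w₁ ∘ r) (w₂ ∘ r) :=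
  ⟨fun _ => h.isP _, fun _ _ => h.eqv _ _,
    fun a b => h.eq (r a.1, r a.2) (r b.1, r b.2)⟩

theorem sameType_embedding (g : N₁ ↪[lang] N₂) (w : κ → N₁) : SameType w (g ∘ w) :=
  ⟨fun k => (embedding_isP g _).symm, fun k l => (embedding_eqv g _ _).symm, fun a b => by
    simp only [pairs, Function.comp_apply, ← embedding_app, g.injective.eq_iff]⟩

/-- Every term reduces to a single application of F to two variables, and the reduction depends only
on which variables lie in P. -/
theorem SameType.exists_realize_term (h₁ : Axioms N₁) (h₂ : Axioms N₂) {w₁ : κ → N₁}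
    {w₂ : κ → N₂} (h : SameType w₁ w₂) (t : lang.Term κ) :
    ∃ a, t.realize w₁ = pairs w₁ a ∧ t.realize w₂ = pairs w₂ a := by
  induction t with
  | var k => exact ⟨(k, k), (h₁.pairs_self _ _).symm, (h₂.pairs_self _ _).symm⟩
  | @func l g ts ih =>
    cases g
    obtain ⟨a, ha₁, ha₂⟩ := ih 0
    obtain ⟨b, hb₁, hb₂⟩ := ih 1
    refine ⟨pairIndex (fun k => IsP (w₁ k)) a b, ?_, ?_⟩
    · rw [← h₁.app_pairs w₁ _ (fun _ => Iff.rfl), ← ha₁, ← hb₁]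
      exact congrArg (Structure.funMap symF) (by ext i; fin_cases i <;> rfl)
    · rw [← h₂.app_pairs w₂ _ h.isP, ← ha₂, ← hb₂]
      exact congrArg (Structure.funMap symF) (by ext i; fin_cases i <;> rfl)

theorem Axioms.eqv_pairs (h : Axioms N₁) (w : κ → N₁) (a b : κ × κ) :
    Eqv (pairs w a) (pairs w b) ↔ Eqv (w a.1) (w b.1) := by
  have key : ∀ x y z t : N₁, Eqv (app x z) (app y t) ↔ Eqv x y := by
    intro x y z t
    by_cases hx : IsP x
    · exact iff_of_false (fun he => (h.eqv_dom _ _ he).1 ((h.isP_app _ _).2 hx))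
        (fun he => (h.eqv_dom _ _ he).1 hx)
    by_cases hy : IsP y
    · exact iff_of_false (fun he => (h.eqv_dom _ _ he).2 ((h.isP_app _ _).2 hy))
        (fun he => (h.eqv_dom _ _ he).2 hy)
    have ex := h.eqv_app hx z
    have ey := h.eqv_app hy t
    exact ⟨fun he => h.eqv_trans _ _ _ ex (h.eqv_trans _ _ _ he (h.eqv_symm _ _ ey)),
      fun he => h.eqv_trans _ _ _ (h.eqv_symm _ _ ex) (h.eqv_trans _ _ _ he ey)⟩
  exact key _ _ _ _

theorem SameType.realize_rel (h₁ : Axioms N₁) (h₂ : Axioms N₂) {w₁ : κ → N₁}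
    {w₂ : κ → N₂} (h : SameType w₁ w₂) {l : ℕ} (r : lang.Relations l) (ts : Fin l → lang.Term κ) :
    Structure.RelMap r (fun i => (ts i).realize w₁) ↔
      Structure.RelMap r (fun i => (ts i).realize w₂) := by
  choose a ha₁ ha₂ using fun i => h.exists_realize_term h₁ h₂ (ts i)
  simp only [ha₁, ha₂]
  cases r
  · refine (iff_of_eq (congrArg (Structure.RelMap symP) (vec1_eta _))).trans (Iff.trans ?_
      (iff_of_eq (congrArg (Structure.RelMap symP) (vec1_eta _))).symm)
    change IsP (pairs w₁ (a 0)) ↔ IsP (pairs w₂ (a 0))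
    rw [h₁.isP_pairs, h₂.isP_pairs, h.isP]
  · refine (iff_of_eq (congrArg (Structure.RelMap symQ) (vec1_eta _))).trans (Iff.trans ?_
      (iff_of_eq (congrArg (Structure.RelMap symQ) (vec1_eta _))).symm)
    change IsQ (pairs w₁ (a 0)) ↔ IsQ (pairs w₂ (a 0))
    rw [h₁.isQ_iff, h₂.isQ_iff, h₁.isP_pairs, h₂.isP_pairs, h.isP]
  · refine (iff_of_eq (congrArg (Structure.RelMap symE) (vec2_eta _))).trans (Iff.trans ?_
      (iff_of_eq (congrArg (Structure.RelMap symE) (vec2_eta _))).symm)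
    change Eqv (pairs w₁ (a 0)) (pairs w₁ (a 1)) ↔ Eqv (pairs w₂ (a 0)) (pairs w₂ (a 1))
    rw [h₁.eqv_pairs, h₂.eqv_pairs, h.eqv]
  · refine (iff_of_eq (congrArg (Structure.RelMap symR) (vec2_eta _))).trans (Iff.trans ?_
      (iff_of_eq (congrArg (Structure.RelMap symR) (vec2_eta _))).symm)
    change Inc (pairs w₁ (a 0)) (pairs w₁ (a 1)) ↔ Inc (pairs w₂ (a 0)) (pairs w₂ (a 1))
    rw [h₁.inc_iff, h₂.inc_iff, h₁.isP_pairs, h₂.isP_pairs, h.isP, h₁.isP_pairs, h₂.isP_pairs,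
      h.isP, h₁.app_pairs w₁ _ (fun _ => Iff.rfl), h₂.app_pairs w₂ _ h.isP, h.eq]

/-- The extension of a tuple by one element. -/
def extend (w : κ → N₁) (u : N₁) : Option κ → N₁ := fun o => o.elim u w

end SameType

/-! ### Isolating formulas and the extension axioms -/

section Formulas

open Classical in
/-- The formula or its negation, according to the truth value `p`. -/
noncomputable def literal {κ : Type*} (p : Prop) (ψ : lang.Formula κ) : lang.Formula κ :=
  if p then ψ else ∼ψ

theorem realize_literal {κ N : Type*} [lang.Structure N] (p : Prop) (ψ : lang.Formula κ)
    (v : κ → N) : (literal p ψ).Realize v ↔ (p ↔ ψ.Realize v) := by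
  unfold literal
  split_ifs with hp
  · simp [hp]
  · simp [hp]

variable {κ : Type} {N₁ N : Type*} [lang.Structure N₁] [lang.Structure N]

def pairTerm (a : κ × κ) : lang.Term κ := symF.apply₂ (Term.var a.1) (Term.var a.2)

theorem realize_pairTerm (a : κ × κ) (v : κ → N) : (pairTerm a).realize v = pairs v a := by
  simp only [pairTerm, Term.realize_functions_apply₂, Term.realize_var]
  rfl

variable [Finite κ]

/-- A formula isolating the quantifier-free type of a finite tuple. -/
noncomputable def typeFormula (w : κ → N₁) : lang.Formula κ :=
  Formula.iInf (fun k => literal (IsP (w k)) (symP.formula₁ (Term.var k))) ⊓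
  (Formula.iInf (fun a : κ × κ => literal (Eqv (w a.1) (w a.2))
    (symE.formula₂ (Term.var a.1) (Term.var a.2))) ⊓
  Formula.iInf (fun ab : (κ × κ) × (κ × κ) => literal (pairs w ab.1 = pairs w ab.2)
    (Term.equal (pairTerm ab.1) (pairTerm ab.2))))

theorem realize_typeFormula (w : κ → N₁) (v : κ → N) :
    (typeFormula w).Realize v ↔ SameType w v := by
  simp only [typeFormula, Formula.realize_inf, Formula.realize_iInf, realize_literal,
    Formula.realize_rel₁, Formula.realize_rel₂, Formula.realize_equal, Term.realize_var,
    realize_pairTerm]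
  constructor
  · rintro ⟨h1, h2, h3⟩
    exact ⟨h1, fun k l => h2 (k, l), fun a b => h3 (a, b)⟩
  · rintro ⟨h1, h2, h3⟩
    exact ⟨h1, fun a => h2 a.1 a.2, fun ab => h3 ab.1 ab.2⟩

/-- Every tuple of the type of `w` has an extension of the type of `(w, u)`. -/
noncomputable def extensionAxiom (w : κ → N₁) (u : N₁) : lang.Sentence :=
  Formula.iAlls κ (((typeFormula w).relabel Sum.inr).imp
    (Formula.iExs Unit ((typeFormula (extend w u)).relabel
      (fun o => o.elim (Sum.inr ()) (Sum.inl ∘ Sum.inr)))))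

theorem realize_extensionAxiom (w : κ → N₁) (u : N₁) :
    N ⊨ extensionAxiom w u ↔
      ∀ v : κ → N, SameType w v → ∃ y, SameType (extend w u) (extend v y) := by
  simp only [extensionAxiom, Sentence.Realize, Formula.realize_iAlls, Formula.realize_imp,
    Formula.realize_iExs, Formula.realize_relabel, realize_typeFormula]
  refine forall_congr' fun v => imp_congr Iff.rfl ?_
  constructor
  · rintro ⟨y, hy⟩
    refine ⟨y (), ?_⟩
    convert hy using 1
    funext o
    cases o <;> rfl
  · rintro ⟨y, hy⟩
    refine ⟨fun _ => y, ?_⟩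
    convert hy using 1
    funext o
    cases o <;> rfl

/-- The model completion of `T_feq`: every one-point extension of a finite tuple that occurs in
some model of `T_feq` is realized. -/
def modelCompletion : lang.Theory :=
  theory ∪ {σ | ∃ (n : ℕ) (K : Theory.ModelType.{0, 0, 0} theory) (w : Fin n → K) (u : K),
    σ = extensionAxiom w u}

theorem models_theory_of_models (N : Type) [lang.Structure N] [hN : N ⊨ modelCompletion] :
    N ⊨ theory := hN.mono Set.subset_union_left

/-- The forth step: `N₁` is itself a model of `T_feq`, so the type of `(w₁, u)` contributes an
extension axiom, which `N₂` satisfies. -/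
theorem exists_sameType_extend {N₁ N₂ : Type} [lang.Structure N₁] [lang.Structure N₂]
    [N₁ ⊨ modelCompletion] [hN₂ : N₂ ⊨ modelCompletion] {w₁ : κ → N₁} {w₂ : κ → N₂}
    (h : SameType w₁ w₂) (u : N₁) : ∃ y, SameType (extend w₁ u) (extend w₂ y) := by
  have : Nonempty N₁ := ⟨u⟩
  have := models_theory_of_models N₁
  obtain ⟨n, ⟨e⟩⟩ := Finite.exists_equiv_fin κ
  have hax : N₂ ⊨ extensionAxiom (w₁ ∘ e.symm) u :=
    modelCompletion.model_iff.1 hN₂ _ (Or.inr ⟨n, .of theory N₁, w₁ ∘ e.symm, u, rfl⟩)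
  obtain ⟨y, hy⟩ := (realize_extensionAxiom _ _).1 hax _ (h.comp e.symm)
  refine ⟨y, ?_⟩
  have := hy.comp (Option.map e)
  convert this using 1 <;> (funext o; cases o <;> simp [extend])

/-- Elimination of quantifiers for `modelCompletion`, by back and forth. -/
theorem SameType.realize_iff {N₁ N₂ : Type} [lang.Structure N₁] [lang.Structure N₂]
    [N₁ ⊨ modelCompletion] [N₂ ⊨ modelCompletion] {n : ℕ} (φ : lang.BoundedFormula κ n)
    {v₁ : κ → N₁} {v₂ : κ → N₂} {xs₁ : Fin n → N₁} {xs₂ : Fin n → N₂}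
    (h : SameType (Sum.elim v₁ xs₁) (Sum.elim v₂ xs₂)) :
    φ.Realize v₁ xs₁ ↔ φ.Realize v₂ xs₂ := by
  have := models_theory_of_models N₁
  have := models_theory_of_models N₂
  have h₁ := axioms_of_model N₁
  have h₂ := axioms_of_model N₂
  induction φ with
  | falsum => rfl
  | equal t s =>
    obtain ⟨a, ha₁, ha₂⟩ := h.exists_realize_term h₁ h₂ t
    obtain ⟨b, hb₁, hb₂⟩ := h.exists_realize_term h₁ h₂ s
    simp only [BoundedFormula.Realize, ha₁, ha₂, hb₁, hb₂]
    exact h.eq a b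
  | rel r ts => exact h.realize_rel h₁ h₂ r ts
  | imp φ ψ ih₁ ih₂ => simp only [BoundedFormula.realize_imp, ih₁ h, ih₂ h]
  | @all n φ ih =>
    simp only [BoundedFormula.realize_all]
    -- Reindexing that identifies the new bound variable, in last position, with `none`.
    let r : κ ⊕ Fin (n + 1) → Option (κ ⊕ Fin n) := Sum.elim (some ∘ Sum.inl)
      (Fin.snoc (α := fun _ => Option (κ ⊕ Fin n)) (some ∘ Sum.inr) none)
    have hsnoc : ∀ {N : Type} (v : κ → N) (xs : Fin n → N) (u : N),
        extend (Sum.elim v xs) u ∘ r = Sum.elim v (Fin.snoc xs u) := by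
      intro N v xs u
      funext i
      rcases i with i | i
      · rfl
      · refine Fin.lastCases ?_ (fun i => ?_) i <;> simp [r, extend]
    have step : ∀ (u₁ : N₁) (u₂ : N₂), SameType (extend (Sum.elim v₁ xs₁) u₁)
        (extend (Sum.elim v₂ xs₂) u₂) →
        (φ.Realize v₁ (Fin.snoc xs₁ u₁) ↔ φ.Realize v₂ (Fin.snoc xs₂ u₂)) := by
      intro u₁ u₂ hu
      apply ih
      rw [← hsnoc, ← hsnoc]
      exact hu.comp _
    constructor
    · intro H u₂
      obtain ⟨u₁, hu⟩ := exists_sameType_extend h.symm u₂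
      exact (step u₁ u₂ hu.symm).1 (H u₁)
    · intro H u₁
      obtain ⟨u₂, hu⟩ := exists_sameType_extend h u₁
      exact (step u₁ u₂ hu).2 (H u₂)

end Formulas

/-! ### Substructures -/

section Substructure

variable {N : Type*} [lang.Structure N]

/-- The substructure on a set closed under `F`. -/
def substructureOfClosed (S : Set N) (hS : ∀ x ∈ S, ∀ z ∈ S, app x z ∈ S) :
    lang.Substructure N where
  carrier := S
  fun_mem := by
    intro n g xs hxs
    cases g
    have : xs = ![xs 0, xs 1] := vec2_eta xs
    rw [this]
    exact hS _ (hxs 0) _ (hxs 1)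

/-- With F in the language all axioms are universal, so they pass to substructures. -/
theorem Axioms.of_embedding {K : Type*} [lang.Structure K] (h : Axioms N) (g : K ↪[lang] N) :
    Axioms K := by
  have hP := embedding_isP g
  have hE := embedding_eqv g
  have hR := embedding_inc g
  have hF := embedding_app g
  have hQ : ∀ x, IsQ (g x) ↔ IsQ x := fun x => by
    have := g.map_rel symQ ![x]
    rwa [show g ∘ ![x] = ![g x] by ext i; fin_cases i; rfl] at this
  constructor
  · intro x; rw [← hQ, ← hP]; exact h.isQ_iff _
  · intro x y; rw [← hE, ← hP, ← hP]; exact h.eqv_dom _ _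
  · intro x; rw [← hE, ← hP]; exact h.eqv_refl _
  · intro x y; rw [← hE, ← hE]; exact h.eqv_symm _ _
  · intro x y z; rw [← hE, ← hE, ← hE]; exact h.eqv_trans _ _ _
  · intro x z; rw [← hR, ← hP, ← hP]; exact h.inc_dom _ _
  · intro x y z; rw [← hR, ← hR, ← hE, ← g.injective.eq_iff]; exact h.inc_unique _ _ _
  · intro x z; rw [← hR, ← hE, ← hP, ← hP, hF]; exact h.app_spec _ _
  · intro x z; rw [← hP, ← hP, ← g.injective.eq_iff, hF]; exact h.app_out _ _

theorem Axioms.app_mem_range_pairs {κ : Type*} (h : Axioms N) (w : κ → N) :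
    ∀ x ∈ Set.range (pairs w), ∀ z ∈ Set.range (pairs w), app x z ∈ Set.range (pairs w) := by
  rintro _ ⟨a, rfl⟩ _ ⟨b, rfl⟩
  exact ⟨_, (h.app_pairs w _ (fun _ => Iff.rfl) a b).symm⟩

end Substructure

/-! ### Rich frames -/

/-- Simultaneous choice of distinct elements outside a finite set. -/
theorem exists_injective_choice {A B : Type*} [Finite A] (good : A → B → Prop) (X : Set B)
    (hX : X.Finite) (H : ∀ a, ∀ Y : Set B, Y.Finite → ∃ b ∉ Y, good a b) :
    ∃ g : A → B, Function.Injective g ∧ ∀ a, g a ∉ X ∧ good a (g a) := by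
  classical
  obtain ⟨n, ⟨e⟩⟩ := Finite.exists_equiv_fin A
  suffices H' : ∀ (n : ℕ) (good : Fin n → B → Prop),
      (∀ a, ∀ Y : Set B, Y.Finite → ∃ b ∉ Y, good a b) →
      ∃ g : Fin n → B, Function.Injective g ∧ ∀ a, g a ∉ X ∧ good a (g a) by
    obtain ⟨g, hg, hg'⟩ := H' n (fun i => good (e.symm i)) fun i => H _
    exact ⟨g ∘ e, hg.comp e.injective, fun a => by simpa using hg' (e a)⟩
  intro n
  induction n with
  | zero => exact fun _ _ => ⟨Fin.elim0, fun a => a.elim0, fun a => a.elim0⟩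
  | succ n ih =>
    intro good H
    obtain ⟨g, hg, hg'⟩ := ih (fun i => good i.succ) fun i => H _
    obtain ⟨b, hb, hb'⟩ := H 0 (X ∪ Set.range g) (hX.union (Set.finite_range g))
    rw [Set.mem_union, not_or] at hb
    refine ⟨Fin.cons b g, Fin.cons_injective_iff.2 ⟨hb.2, hg⟩, fun a => ?_⟩
    refine Fin.cases ⟨hb.1, hb'⟩ (fun i => ?_) a
    simpa using hg' i

/-- A frame is rich if `F` takes arbitrary values on finitely many classes at infinitely many
points, and on finitely many points in infinitely many classes. -/
structure Rich {P C V : Type*} (f : C → P → V) : Prop where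
  infinite : Infinite V
  points : ∀ (D : Set C) (_ : D.Finite) (v : C → V) (A : Set P) (_ : A.Finite),
    ∃ p ∉ A, ∀ c ∈ D, f c p = v c
  classes : ∀ (D : Set P) (_ : D.Finite) (v : P → V) (A : Set C) (_ : A.Finite),
    ∃ c ∉ A, ∀ p ∈ D, f c p = v p

/-- New elements first get values in V not used by the tuple. Then new points are chosen with the
required values on the finitely many classes of the tuple, and finally new classes with the required
values at all points, old and new. Classes come last because their values at the new points must be
prescribed too. -/
theorem Rich.exists_embedding {P C V : Type*} {f : C → P → V} (hf : Rich f) {K : Type*}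
    [lang.Structure K] [Finite K] (h : Axioms K) {κ : Type*} [Finite κ] (w₁ : κ → K)
    (w : κ → Frame f) (hw : SameType w₁ w) : ∃ g : K ↪[lang] Frame f, ∀ k, g (w₁ k) = w k := by
  classical
  have hF := Frame.axioms f
  obtain ⟨p₀, -⟩ := hf.points ∅ Set.finite_empty (fun _ => hf.infinite.nonempty.some) ∅
    Set.finite_empty
  have := hf.infinite
  obtain ⟨v₀⟩ := hf.infinite.nonempty
  obtain ⟨c₀, -⟩ := hf.classes ∅ Set.finite_empty (fun _ => v₀) ∅ Set.finite_empty
  obtain ⟨πF, hπF⟩ : ∃ π : Frame f → P, ∀ p, IsP p → p = Frame.point (π p) := by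
    refine ⟨fun x => x.elim id fun _ => p₀, fun p hp => ?_⟩
    rcases Frame.cases p with ⟨p, rfl⟩ | ⟨c, v, rfl⟩
    · rfl
    · simp at hp
  obtain ⟨cF, vF, hcF⟩ : ∃ (c : Frame f → C) (v : Frame f → V), ∀ q, ¬ IsP q →
      q = Frame.elt (c q) (v q) := by
    refine ⟨fun x => x.elim (fun _ => c₀) Prod.fst, fun x => x.elim (fun _ => v₀) Prod.snd,
      fun q hq => ?_⟩
    rcases Frame.cases q with ⟨p, rfl⟩ | ⟨c, v, rfl⟩
    · simp at hq
    · rfl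
  have cF_eq : ∀ x y : Frame f, ¬ IsP x → ¬ IsP y → (cF x = cF y ↔ Eqv x y) := by
    intro x y hx hy
    conv_rhs => rw [hcF x hx, hcF y hy, Frame.eqv_elt]
  obtain ⟨s, hs⟩ : ∃ s : K → Frame f, ∀ a, s (pairs w₁ a) = pairs w a :=
    ⟨Function.extend (pairs w₁) (pairs w) fun _ => Frame.point p₀, fun a =>
      Function.FactorsThrough.extend_apply (fun _ _ e => (hw.eq _ _).1 e) _ a⟩
  have hs' : ∀ k, s (w₁ k) = w k := fun k => by
    have := hs (k, k)
    rwa [h.pairs_self, hF.pairs_self] at this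
  have splitP : ∀ p, IsP p → (∃ k, w₁ k = p) ∨ ∀ a, pairs w₁ a ≠ p := by
    intro p hp
    by_cases ha : ∃ a, pairs w₁ a = p
    · obtain ⟨a, rfl⟩ := ha
      exact Or.inl ⟨a.1, (h.app_out _ _ (Or.inl ((h.isP_pairs _ _).1 hp))).symm⟩
    · exact Or.inr (by simpa using ha)
  have split : ∀ q : K, (∃ a, pairs w₁ a = q) ∨ ∀ a, pairs w₁ a ≠ q := fun q => by
    by_cases hk : ∃ k, pairs w₁ k = q
    exacts [Or.inl hk, Or.inr (by simpa using hk)]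
  have splitE : ∀ q : K, (∃ k, Eqv (w₁ k) q) ∨ ∀ k, ¬ Eqv (w₁ k) q := fun q => by
    by_cases hk : ∃ k, Eqv (w₁ k) q
    exacts [Or.inl hk, Or.inr (by simpa using hk)]
  have not_isP : ∀ k q, Eqv (w₁ k) q → ¬ IsP (w k) := fun k q hk =>
    (hw.isP k).not.1 (h.eqv_dom _ _ hk).1
  -- new values
  obtain ⟨τ, τ_inj, hτ⟩ := exists_injective_choice (A := K) (fun _ (_ : V) => True)
    (Set.range (vF ∘ pairs w)) (Set.finite_range _) fun _ Y hY => by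
      obtain ⟨v, hv⟩ := hY.exists_notMem
      exact ⟨v, hv, trivial⟩
  let ν : K → V := fun q => if q ∈ Set.range (pairs w₁) then vF (s q) else τ q
  have ν_pos : ∀ a, ν (pairs w₁ a) = vF (pairs w a) := fun a =>
    (if_pos ⟨a, rfl⟩).trans (by rw [hs])
  have ν_neg : ∀ q, (∀ a, pairs w₁ a ≠ q) → ν q = τ q := fun q hq =>
    if_neg fun ⟨k, hk⟩ => hq k hk
  -- new points
  obtain ⟨π₀, π₀_inj, hπ₀⟩ := exists_injective_choice (A := K)
    (fun p b => IsP p → ∀ k, ¬ IsP (w₁ k) → f (cF (w k)) b = ν (app (w₁ k) p))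
    (Set.range (πF ∘ w)) (Set.finite_range _) fun p Y hY => by
      obtain ⟨b, hb, hb'⟩ := hf.points (Set.range (cF ∘ w)) (Set.finite_range _)
        (fun c => if hk : ∃ k, ¬ IsP (w₁ k) ∧ cF (w k) = c then ν (app (w₁ hk.choose) p) else v₀)
        Y hY
      refine ⟨b, hb, fun hp k hk => ?_⟩
      have hk' : ∃ k', ¬ IsP (w₁ k') ∧ cF (w k') = cF (w k) := ⟨k, hk, rfl⟩
      rw [hb' (cF (w k)) ⟨k, rfl⟩, dif_pos hk']
      have h1 := hk'.choose_spec
      rw [h.app_congr ((hw.eqv _ _).2 ((cF_eq _ _ ((hw.isP _).not.1 h1.1)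
        ((hw.isP _).not.1 hk)).1 h1.2)) hp]
  let π : K → P := fun p => if p ∈ Set.range (pairs w₁) then πF (s p) else π₀ p
  have π_pos : ∀ k, π (w₁ k) = πF (w k) := fun k =>
    (if_pos ⟨(k, k), h.pairs_self _ _⟩).trans (by rw [hs'])
  have π_neg : ∀ q, (∀ a, pairs w₁ a ≠ q) → π q = π₀ q := fun q hq =>
    if_neg fun ⟨k, hk⟩ => hq k hk
  have π_inj : ∀ p p', IsP p → IsP p' → π p = π p' → p = p' := by
    intro p p' hp hp' he
    rcases splitP p hp with ⟨k, rfl⟩ | hk <;> rcases splitP p' hp' with ⟨k', rfl⟩ | hk'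
    · rw [π_pos, π_pos] at he
      have : w k = w k' := by
        rw [hπF _ ((hw.isP _).1 hp), hπF _ ((hw.isP _).1 hp'), he]
      rw [← h.pairs_self w₁, ← h.pairs_self w₁ k', hw.eq, hF.pairs_self, hF.pairs_self, this]
    · rw [π_pos, π_neg _ hk'] at he
      exact absurd ⟨k, he⟩ (hπ₀ _).1
    · rw [π_pos, π_neg _ hk] at he
      exact absurd ⟨k', he.symm⟩ (hπ₀ _).1
    · rw [π_neg _ hk, π_neg _ hk'] at he
      exact π₀_inj he
  -- new classes
  have : Finite h.Cls := Quotient.finite _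
  obtain ⟨γ₀, γ₀_inj, hγ₀⟩ := exists_injective_choice (A := h.Cls)
    (fun c b => ∀ p, IsP p → f b (π p) = τ (app (h.rep c) p))
    (Set.range (cF ∘ w)) (Set.finite_range _) fun c Y hY => by
      obtain ⟨b, hb, hb'⟩ := hf.classes (Set.range π) (Set.finite_range _)
        (fun x => if hp : ∃ p, IsP p ∧ π p = x then τ (app (h.rep c) hp.choose) else v₀) Y hY
      refine ⟨b, hb, fun p hp => ?_⟩
      have hp' : ∃ p', IsP p' ∧ π p' = π p := ⟨p, hp, rfl⟩
      rw [hb' _ ⟨p, rfl⟩, dif_pos hp', π_inj _ _ hp'.choose_spec.1 hp hp'.choose_spec.2]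
  let γ : K → C := fun q => if hk : ∃ k, Eqv (w₁ k) q then cF (w hk.choose) else γ₀ (h.cls q)
  have γ_pos : ∀ k q, Eqv (w₁ k) q → γ q = cF (w k) := by
    intro k q hq
    have hk : ∃ k, Eqv (w₁ k) q := ⟨k, hq⟩
    simp only [γ, dif_pos hk]
    rw [cF_eq _ _ (not_isP _ _ hk.choose_spec) (not_isP _ _ hq), ← hw.eqv]
    exact h.eqv_trans _ _ _ hk.choose_spec (h.eqv_symm _ _ hq)
  have γ_neg : ∀ q, (∀ k, ¬ Eqv (w₁ k) q) → γ q = γ₀ (h.cls q) := fun q hq =>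
    dif_neg fun ⟨k, hk⟩ => hq k hk
  have pairs_ne : ∀ q, (∀ k, ¬ Eqv (w₁ k) q) → ¬ IsP q → ∀ a, pairs w₁ a ≠ q := by
    rintro _ hq hP a rfl
    exact hq a.1 (h.eqv_app ((h.isP_pairs _ _).not.1 hP) _)
  obtain ⟨g, g1, g2⟩ := Frame.exists_embedding (f := f) h π γ ν π_inj (by
      intro q q' hq hq'
      rcases splitE q with ⟨k, hk⟩ | hk <;> rcases splitE q' with ⟨k', hk'⟩ | hk'
      · rw [γ_pos k q hk, γ_pos k' q' hk', cF_eq _ _ (not_isP _ _ hk) (not_isP _ _ hk'), ← hw.eqv]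
        exact ⟨fun he => h.eqv_trans _ _ _ (h.eqv_symm _ _ hk) (h.eqv_trans _ _ _ he hk'),
          fun he => h.eqv_trans _ _ _ hk (h.eqv_trans _ _ _ he (h.eqv_symm _ _ hk'))⟩
      · rw [γ_pos k q hk, γ_neg _ hk']
        exact iff_of_false (fun he => (hγ₀ _).1 ⟨k, he⟩)
          fun he => hk' k (h.eqv_trans _ _ _ hk he)
      · rw [γ_pos k' q' hk', γ_neg _ hk]
        exact iff_of_false (fun he => (hγ₀ _).1 ⟨k', he.symm⟩)
          fun he => hk k' (h.eqv_trans _ _ _ hk' (h.eqv_symm _ _ he))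
      · rw [γ_neg _ hk, γ_neg _ hk', γ₀_inj.eq_iff, h.cls_eq_iff hq]) (by
      intro q q' hE he
      rcases split q with ⟨a, rfl⟩ | hk <;> rcases split q' with ⟨a', rfl⟩ | hk'
      · rw [ν_pos, ν_pos] at he
        have e₁ : Eqv (pairs w a) (pairs w a') := by
          rw [hF.eqv_pairs, ← hw.eqv, ← h.eqv_pairs]; exact hE
        obtain ⟨n₁, n₂⟩ := hF.eqv_dom _ _ e₁
        rw [hw.eq, hcF _ n₁, hcF _ n₂, he, (cF_eq _ _ n₁ n₂).2 e₁]
      · rw [ν_pos, ν_neg _ hk'] at he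
        exact absurd ⟨a, he⟩ (hτ _).1
      · rw [ν_pos, ν_neg _ hk] at he
        exact absurd ⟨a', he.symm⟩ (hτ _).1
      · rw [ν_neg _ hk, ν_neg _ hk'] at he
        exact τ_inj he) (by
      intro q p hq hp
      rcases splitE q with ⟨k, hk⟩ | hk
      · rw [γ_pos k q hk, ← h.app_congr hk hp]
        rcases splitP p hp with ⟨l, rfl⟩ | hl
        · rw [π_pos, show app (w₁ k) (w₁ l) = pairs w₁ (k, l) from rfl, ν_pos]
          have hk' := not_isP _ _ hk
          have hl' := (hw.isP l).1 hp
          have e₁ : pairs w (k, l) = Frame.elt (cF (w k)) (f (cF (w k)) (πF (w l))) := by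
            rw [← Frame.app_elt_point (cF (w k)) (vF (w k)), ← hcF _ hk', ← hπF _ hl']
            rfl
          have e₂ := hcF (pairs w (k, l)) (by rw [e₁]; simp)
          rw [e₁] at e₂
          conv_rhs => rw [e₁]
          exact (Frame.elt_inj.1 e₂).2
        · rw [π_neg _ hl]
          exact (hπ₀ p).2 hp k (h.eqv_dom _ _ hk).1
      · rw [γ_neg _ hk, ν_neg, (hγ₀ _).2 p hp, h.app_rep hq hp]
        refine pairs_ne _ (fun k hk' => ?_) ((h.isP_app _ _).not.2 hq)
        exact hk k (h.eqv_trans _ _ _ hk' (h.eqv_symm _ _ (h.eqv_app hq p))))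
  refine ⟨g, fun k => ?_⟩
  by_cases hk : IsP (w₁ k)
  · rw [g1 _ hk, π_pos, ← hπF _ ((hw.isP k).1 hk)]
  · have := ν_pos (k, k)
    rw [h.pairs_self, hF.pairs_self] at this
    rw [g2 _ hk, γ_pos k _ (h.eqv_refl _ hk), this, ← hcF _ ((hw.isP k).not.1 hk)]

/-- The tuple together with its extra element generates a finite substructure, which
`Rich.exists_embedding` places over the given tuple. -/
theorem Rich.models {P C V : Type} {f : C → P → V} (hf : Rich f) :
    (Frame f) ⊨ modelCompletion := by
  refine modelCompletion.model_iff.2 ?_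
  rintro _ (hσ | ⟨n, K, w, u, rfl⟩)
  · exact theory.realize_sentence_of_mem hσ
  rw [realize_extensionAxiom]
  intro v hv
  have h := axioms_of_model K
  let S := substructureOfClosed _ (h.app_mem_range_pairs (extend w u))
  have hS : Finite S := (Set.finite_range (pairs (extend w u))).to_subtype
  let w' : Option (Fin n) → S := fun o => ⟨extend w u o, (o, o), h.pairs_self _ _⟩
  have hw' : SameType w' (extend w u) := sameType_embedding S.subtype w'
  obtain ⟨g, hg⟩ := hf.exists_embedding (h.of_embedding S.subtype) (w' ∘ some) v
    ((hw'.comp some).trans hv)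
  refine ⟨g (w' none), hw'.symm.trans ?_⟩
  have : extend v (g (w' none)) = g ∘ w' := by
    funext o
    cases o
    · rfl
    · exact (hg _).symm
  rw [this]
  exact sameType_embedding g w'

/-! ### Existence of rich frames -/

/-- To the points and classes of N are added points and classes named by finitely supported
functions, each in infinitely many copies. A new point should be a function on classes and a new
class a function on points; the circularity is avoided by letting points be functions on V, into
which the classes inject by cardinality. -/
theorem exists_rich_frame (N : Type) [lang.Structure N] (h : Axioms N) :
    ∃ (P C V : Type) (f : C → P → V), Rich f ∧ Nonempty (N ↪[lang] Frame f) := by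
  classical
  let V := N ⊕ ℕ
  let zero : Zero V := ⟨Sum.inr 0⟩
  let P := N ⊕ (V →₀ V) × ℕ
  let C := h.Cls ⊕ (P →₀ V) × ℕ
  have card_N : Cardinal.mk N ≤ Cardinal.mk V := Cardinal.mk_le_of_injective Sum.inl_injective
  have inf : Cardinal.aleph0 ≤ Cardinal.mk V := Cardinal.aleph0_le_mk V
  have card_P : Cardinal.mk P ≤ Cardinal.mk V := by
    have : Cardinal.mk P = Cardinal.mk N + Cardinal.mk (V →₀ V) * Cardinal.aleph0 := by simp [P]
    rw [this, Cardinal.mk_finsupp_of_infinite, max_self]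
    refine Cardinal.add_le_of_le inf card_N ?_
    exact Cardinal.mul_le_of_le inf le_rfl inf
  have card_C : Cardinal.mk C ≤ Cardinal.mk V := by
    have : Cardinal.mk C = Cardinal.mk h.Cls + Cardinal.mk (P →₀ V) * Cardinal.aleph0 := by
      simp [C]
    have : Nonempty P := ⟨Sum.inr (0, 0)⟩
    rw [‹Cardinal.mk C = _›, Cardinal.mk_finsupp_of_infinite', max_eq_right card_P]
    refine Cardinal.add_le_of_le inf (Cardinal.mk_quotient_le.trans card_N) ?_
    exact Cardinal.mul_le_of_le inf le_rfl inf
  obtain ⟨ι⟩ : Nonempty (C ↪ V) := card_C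
  let dflt : C → P → V := fun c p => p.elim (fun _ => 0) fun g => g.1 (ι c)
  -- Where a new class and a new point both prescribe a value, the class wins unless its own value
  -- is 0.
  let f : C → P → V
    | Sum.inl c, Sum.inl p => Sum.inl (app (h.rep c) p)
    | Sum.inl c, Sum.inr g => dflt (Sum.inl c) (Sum.inr g)
    | Sum.inr t, p => if t.1 p = 0 then dflt (Sum.inr t) p else t.1 p
  have ind : ∀ {A : Type} (D : Set A), D.Finite → ∀ v : A → V, ∃ g : A →₀ V, ∀ x ∈ D, g x = v x :=
    fun D hD v => ⟨Finsupp.indicator hD.toFinset fun i _ => v i, fun x hx =>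
      Finsupp.indicator_of_mem (hD.mem_toFinset.2 hx) _⟩
  have tag : ∀ {A B : Type} (g : B) (X : Set (A ⊕ B × ℕ)), X.Finite →
      ∃ n, (Sum.inr (g, n) : A ⊕ B × ℕ) ∉ X := fun g X hX =>
    (hX.preimage (f := fun n : ℕ => (Sum.inr (g, n) : _ ⊕ _ × ℕ))
      fun n _ n' _ hn => (Prod.ext_iff.1 (Sum.inr_injective hn)).2).exists_notMem
  refine ⟨P, C, V, f, ⟨inferInstance, ?_, ?_⟩, ?_⟩
  · intro D hD v A hA
    obtain ⟨g, hg⟩ := ind (ι '' D) (hD.image ι) (v ∘ Function.invFun ι)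
    have hg' : ∀ c ∈ D, g (ι c) = v c := fun c hc => by
      rw [hg _ ⟨c, hc, rfl⟩, Function.comp_apply, Function.leftInverse_invFun ι.injective]
    let supp : C → Set P := fun c => c.elim (fun _ => ∅) fun t => t.1.support
    -- A copy of the point outside the supports of the classes in `D`, so that none of them
    -- overrides its values.
    obtain ⟨n, hn⟩ := tag g (A ∪ ⋃ c ∈ D, supp c) (hA.union (hD.biUnion fun c _ => by
      rcases c with c | t
      exacts [Set.finite_empty, t.1.support.finite_toSet]))
    simp only [Set.mem_union, Set.mem_iUnion, not_or, not_exists] at hn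
    refine ⟨_, hn.1, fun c hc => ?_⟩
    have := hn.2 c hc
    rcases c with c | t
    · exact hg' _ hc
    · have : t.1 (Sum.inr (g, n)) = 0 := by simpa [supp] using this
      simp only [f, if_pos this]
      exact hg' _ hc
  · intro D hD v A hA
    obtain ⟨g, hg⟩ := ind D hD v
    let supp : P → Set V := fun p => p.elim (fun _ => ∅) fun t => t.1.support
    obtain ⟨n, hn⟩ := tag g (A ∪ ι ⁻¹' ⋃ p ∈ D, supp p)
      (hA.union (Set.Finite.preimage ι.injective.injOn (hD.biUnion fun c _ => by
        rcases c with c | t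
        exacts [Set.finite_empty, t.1.support.finite_toSet])))
    simp only [Set.mem_union, Set.mem_preimage, Set.mem_iUnion, not_or, not_exists] at hn
    refine ⟨_, hn.1, fun p hp => ?_⟩
    simp only [f, hg p hp]
    split_ifs with h0
    -- The prescribed value is 0, so the point decides; the copy of the class was chosen with its
    -- code outside the supports of the points in `D`, hence the point gives 0 as well.
    · rw [h0]
      have := hn.2 p hp
      rcases p with p | t
      · rfl
      · have : t.1 (ι (Sum.inr (g, n))) = 0 := by simpa [supp] using this
        exact this
    · rfl
  · obtain ⟨e, -, -⟩ := Frame.exists_embedding (f := f) h Sum.inl (fun q => Sum.inl (h.cls q))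
      Sum.inl (fun p p' _ _ hp => Sum.inl_injective hp)
      (fun q q' hq _ => by rw [Sum.inl_injective.eq_iff, h.cls_eq_iff hq])
      (fun q q' _ hq => Sum.inl_injective hq)
      (fun q p hq hp => by simp only [f]; rw [h.app_rep hq hp])
    exact ⟨e⟩

theorem isModelCompletion_modelCompletion : IsModelCompletion theory modelCompletion where
  extends_base _ hφ := Theory.models_sentence_of_mem (Or.inl hφ)
  embeds M := by
    obtain ⟨P, C, V, f, hf, ⟨g⟩⟩ := exists_rich_frame M (axioms_of_model M)
    have := hf.models
    have : Nonempty (Frame f) := ⟨g (Classical.arbitrary M)⟩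
    exact ⟨.of modelCompletion (Frame f), ⟨g⟩⟩
  diagram_complete M N₁ N₂ f₁ f₂ n φ c := by
    refine SameType.realize_iff φ ?_
    have := (sameType_embedding f₁ (Sum.elim c Fin.elim0)).symm.trans
      (sameType_embedding f₂ (Sum.elim c Fin.elim0))
    rw [Sum.comp_elim, Sum.comp_elim] at this
    convert this using 2

end Feq

theorem mainTheorem1 :
    (∃ Tstar : Feq.lang.Theory, IsModelCompletion Feq.theory Tstar) ∧
    (∀ Tstar : Feq.lang.Theory, IsModelCompletion Feq.theory Tstar →
      Tstar.IsComplete ∧ ¬ HasSOP1 Tstar ∧ ¬ IsSimpleTheory Tstar) ∧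
    (∀ (L : FirstOrder.Language.{u, v}) (T : L.Theory),
      T.IsComplete → IsSimpleTheory T → ¬ HasSOP1 T) :=
  ⟨⟨_, Feq.isModelCompletion_modelCompletion⟩,
    fun _ hT => ⟨Feq.isComplete hT, Feq.not_hasSOP1 hT, Feq.not_isSimpleTheory hT⟩,
    fun _ _ _ hT => hT.not_hasSOP1⟩
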